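/- **Conventions.** All rings are commutative and unital. An *$\ell$-algebra* is an $\mathbb R$-algebra $A$ with a lattice order such that $a\le b$ implies $a+c\le b+c$, such that $0\le a,b$ implies $0\le ab$, such that $0\le a\in A$ and $0\le r\in\mathbb R$ imply $0\le r\cdot a$, and such that $0\le 1$; homomorphisms of $\ell$-algebras are unital algebra homomorphisms preserving binary joins and meets. $A$ is *bounded* if for each $a\in A$ there is $n\in\mathbb N$ with $a\le n\cdot 1$, and *archimedean* if, whenever $n\cdot a\le b$ for all $n\in\mathbb N$, then $a\le 0$. Let $\boldsymbol{ba\ell}$ be the category of bounded archimedean $\ell$-algebras and $\ell$-algebra homomorphisms. For $A\in\boldsymbol{ba\ell}$ put $|a|=a\vee(-a)$ and $\|a\|=\inf\{r\ge 0 : |a|\le r\cdot 1\}$. A *basic algebra* is an $A\in\boldsymbol{ba\ell}$ that is Dedekind complete (each nonempty subset that is bounded above has a least upper bound) and whose boolean algebra of idempotents is atomic. Let $\boldsymbol{balg}$ be the category of basic algebras and *normal homomorphisms*, i.e. $\boldsymbol{ba\ell}$-morphisms that preserve all existing joins and meets. A *weighted set* $(X,w)$ is a set $X$ with a function $w:X\to[0,\infty)$;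 a morphism $(X_1,w_1)\to(X_2,w_2)$ is a function $f$ with $w_2(f(x))\le w_1(x)$ for all $x\in X_1$. Let $\mathsf{WSet}$ be the resulting category. The forgetful functors from $\boldsymbol{ba\ell}$ and from $\boldsymbol{balg}$ to $\mathsf{WSet}$ send $A$ to $(A,\|\cdot\|)$. For a weighted set $(X,w)$ let $G(X)$ be the free $\ell$-algebra on $X$, with generators $g(x)$, let $I$ be the smallest ideal of $G(X)$ that contains all $g(x)-((g(x)\vee -w(x))\wedge w(x))$, that satisfies $a\in I$ whenever $|a|\le|b|$ and $b\in I$, and for which the quotient is archimedean, and let $F(X,w)=G(X)/I\in\boldsymbol{ba\ell}$, with $f:X\to F(X,w)$ sending $x$ to the class of $g(x)$. For a morphism $h:(X,w)\to(X',w')$ let $F(h)$ be the unique $\boldsymbol{ba\ell}$-morphism with $F(h)\circ f=f\circ h$; this makes $F:\mathsf{WSet}\to\boldsymbol{ba\ell}$ a functor. A *canonical extension* of $A\in\boldsymbol{ba\ell}$ is a basic algebra $A^\sigma$ with an injective $\boldsymbol{ba\ell}$-morphism $e:A\to A^\sigma$ such that 1. (density) each element of $A^\sigma$ is a join of meets of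 elements of $e[A]$; 2. (compactness) for all nonempty $S,T\subseteq A$ for which $\bigwedge e[S]$ and $\bigvee e[T]$ exist and each real $\varepsilon>0$, if $\bigwedge e[S]+\varepsilon\cdot 1\le\bigvee e[T]$, then $\bigwedge e[S']\le\bigvee e[T']$ for some nonempty finite $S'\subseteq S$ and $T'\subseteq T$. **Proposition.** The forgetful functor $U:\boldsymbol{balg}\to\mathsf{WSet}$ has a left adjoint $L$, and $L$ is given by the canonical extension of $F(X,w)$: there are a functor $L:\mathsf{WSet}\to\boldsymbol{balg}$, an adjunction $L\dashv U$, and $\boldsymbol{ba\ell}$-morphisms $e_{(X,w)}:F(X,w)\to L(X,w)$, natural in $(X,w)$, such that for every weighted set $(X,w)$ the pair $(L(X,w),e_{(X,w)})$ is a canonical extension of $F(X,w)$ and the unit of the adjunction at $(X,w)$ is $e_{(X,w)}\circ f$. -/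

import Mathlib

open CategoryTheory

universe u

namespace WeightedFree

/-! ### Lattice-ordered algebras -/

/-- A (commutative, unital) lattice-ordered real algebra: a lattice order on a commutative
`ℝ`-algebra for which addition is monotone, products of nonnegative elements and nonnegative
multiples of nonnegative elements are nonnegative, and `0 ≤ 1`. The last condition is automatic
when `1` is a strong order unit. -/
class LAlgebra (A : Type u) extends
  CommRing A, Lattice A, Algebra ℝ A, IsOrderedRing A, IsOrderedModule ℝ A

/-- A unital homomorphism of lattice-ordered algebras: an `ℝ`-algebra homomorphism that is also
a lattice homomorphism. -/
@[ext]
structure LHom (A B : Type u) [LAlgebra A] [LAlgebra B] where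
  toAlgHom : A →ₐ[ℝ] B
  map_sup : ∀ a b, toAlgHom (a ⊔ b) = toAlgHom a ⊔ toAlgHom b
  map_inf : ∀ a b, toAlgHom (a ⊓ b) = toAlgHom a ⊓ toAlgHom b

namespace LHom

variable {A B C : Type u} [LAlgebra A] [LAlgebra B] [LAlgebra C]

instance : CoeFun (LHom A B) (fun _ => A → B) := ⟨fun f => f.toAlgHom⟩

/-- The identity homomorphism. -/
def id (A : Type u) [LAlgebra A] : LHom A A := ⟨AlgHom.id ℝ A, fun _ _ => rfl, fun _ _ => rfl⟩

/-- `f.comp g` is `f` after `g`. -/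
def comp (f : LHom B C) (g : LHom A B) : LHom A C :=
  ⟨f.toAlgHom.comp g.toAlgHom, fun a b => by simp [g.map_sup, f.map_sup],
    fun a b => by simp [g.map_inf, f.map_inf]⟩

theorem mono (f : LHom A B) {a b : A} (h : a ≤ b) : f a ≤ f b := by
  rw [← sup_eq_right, ← f.map_sup, sup_eq_right.2 h]

theorem map_abs (f : LHom A B) (a : A) : f |a| = |f a| := by
  simp [abs, f.map_sup]

end LHom

/-- `A` is bounded: `1` is a strong order unit. -/
def IsBounded (A : Type u) [LAlgebra A] : Prop :=
  ∀ a : A, ∃ n : ℕ, a ≤ n • (1 : A)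

/-- `A` is archimedean. -/
def IsArch (A : Type u) [LAlgebra A] : Prop :=
  ∀ a b : A, (∀ n : ℕ, n • a ≤ b) → a ≤ 0

/-- The norm `‖a‖ = inf {r | |a| ≤ r • 1}`. In a nonzero bounded algebra every such `r` is
nonnegative; restricting to `0 ≤ r` only gives the zero algebra the norm `0`. -/
noncomputable def lnorm {A : Type u} [LAlgebra A] (a : A) : ℝ :=
  sInf {r : ℝ | 0 ≤ r ∧ |a| ≤ r • (1 : A)}

section norm

variable {A B : Type u} [LAlgebra A] [LAlgebra B]

theorem lnorm_nonneg (a : A) : 0 ≤ lnorm a := Real.sInf_nonneg fun _ h => h.1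

theorem lnorm_le {a : A} {r : ℝ} (hr : 0 ≤ r) (h : |a| ≤ r • (1 : A)) : lnorm a ≤ r :=
  csInf_le ⟨0, fun _ h => h.1⟩ ⟨hr, h⟩

theorem lnorm_map_le (hA : IsBounded A) (f : LHom A B) (a : A) : lnorm (f a) ≤ lnorm a := by
  refine le_csInf ?_ fun r hr => lnorm_le hr.1 ?_
  · obtain ⟨n, hn⟩ := hA |a|
    exact ⟨n, n.cast_nonneg, by rwa [Nat.cast_smul_eq_nsmul]⟩
  · rw [← f.map_abs]
    simpa using f.mono hr.2

theorem lnorm_set_nonempty (hA : IsBounded A) (a : A) :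
    {r : ℝ | 0 ≤ r ∧ |a| ≤ r • (1 : A)}.Nonempty := by
  obtain ⟨n, hn⟩ := hA |a|
  exact ⟨n, n.cast_nonneg, by rwa [Nat.cast_smul_eq_nsmul]⟩

/-- In an archimedean algebra the infimum defining the norm is attained. -/
theorem abs_le_lnorm (hA : IsBounded A) (hA' : IsArch A) (a : A) : |a| ≤ lnorm a • (1 : A) := by
  have key : ∀ n : ℕ, n • (|a| - lnorm a • (1 : A)) ≤ 1 := by
    intro n
    have hn : (0 : ℝ) < n + 1 := by positivity
    obtain ⟨r, hr, hr'⟩ := exists_lt_of_csInf_lt (lnorm_set_nonempty hA a)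
      (show sInf _ < lnorm a + 1 / ((n : ℝ) + 1) from lt_add_of_pos_right _ (by positivity))
    have h1 : |a| - lnorm a • (1 : A) ≤ (1 / ((n : ℝ) + 1)) • (1 : A) := by
      rw [sub_le_iff_le_add, ← add_smul]
      refine hr.2.trans (smul_le_smul_of_nonneg_right ?_ zero_le_one)
      linarith
    calc n • (|a| - lnorm a • (1 : A)) ≤ n • ((1 / ((n : ℝ) + 1)) • (1 : A)) :=
          nsmul_le_nsmul_right h1 n
      _ = ((n : ℝ) * (1 / ((n : ℝ) + 1))) • (1 : A) := by
          rw [← Nat.cast_smul_eq_nsmul ℝ, smul_smul]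
      _ ≤ (1 : ℝ) • (1 : A) := by
          refine smul_le_smul_of_nonneg_right ?_ zero_le_one
          rw [mul_one_div, div_le_one hn]
          linarith
      _ = 1 := one_smul _ _
  exact sub_nonpos.1 (hA' _ _ key)

end norm

/-! ### The category of bounded archimedean lattice-ordered algebras -/

/-- A bounded archimedean lattice-ordered algebra. -/
structure BAl : Type (u + 1) where
  carrier : Type u
  [str : LAlgebra carrier]
  bounded : IsBounded carrier
  arch : IsArch carrier

attribute [instance] BAl.str

instance : CoeSort BAl.{u} (Type u) := ⟨BAl.carrier⟩

/-- The category of bounded archimedean lattice-ordered algebras and unital homomorphisms of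
lattice-ordered algebras. -/
instance : Category.{u} BAl.{u} where
  Hom A B := LHom A B
  id A := LHom.id A
  comp f g := LHom.comp g f

/-! ### Basic algebras and normal homomorphisms -/

/-- Every nonempty set that is bounded above has a least upper bound. -/
def IsDedekindComplete (A : Type u) [LAlgebra A] : Prop :=
  ∀ S : Set A, S.Nonempty → BddAbove S → ∃ a, IsLUB S a

/-- The set of idempotents of a commutative ring. -/
def Idempotents (A : Type u) [CommRing A] : Type u := {e : A // IsIdempotentElem e}

/-- The idempotents form a boolean algebra with `e ⊔ f = e + f - e * f`, `e ⊓ f = e * f` and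
`eᶜ = 1 - e`. -/
instance (A : Type u) [CommRing A] : BooleanAlgebra (Idempotents A) :=
  inferInstanceAs (BooleanAlgebra {e : A // IsIdempotentElem e})

/-- A basic algebra: a Dedekind complete bounded archimedean lattice-ordered algebra whose boolean
algebra of idempotents is atomic. -/
structure BAlg : Type (u + 1) where
  toBAl : BAl.{u}
  complete : IsDedekindComplete toBAl
  atomic : IsAtomic (Idempotents toBAl)

/-- A normal homomorphism preserves all existing joins and meets. -/
structure IsNormal {A B : Type u} [LAlgebra A] [LAlgebra B] (f : LHom A B) : Prop where
  map_isLUB : ∀ (S : Set A) (a : A), IsLUB S a → IsLUB (f '' S) (f a)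
  map_isGLB : ∀ (S : Set A) (a : A), IsGLB S a → IsGLB (f '' S) (f a)

/-- The category of basic algebras and normal homomorphisms. -/
instance : Category.{u} BAlg.{u} where
  Hom A B := {f : LHom A.toBAl B.toBAl // IsNormal f}
  id A := ⟨LHom.id A.toBAl, ⟨fun S a h => by simpa [LHom.id] using h,
    fun S a h => by simpa [LHom.id] using h⟩⟩
  comp {A B C} f g := ⟨LHom.comp g.1 f.1,
    ⟨fun S a h => by
      have := g.2.map_isLUB _ _ (f.2.map_isLUB S a h)
      rwa [Set.image_image] at this,
    fun S a h => by
      have := g.2.map_isGLB _ _ (f.2.map_isGLB S a h)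
      rwa [Set.image_image] at this⟩⟩

/-- The (non-full) inclusion of basic algebras into bounded archimedean algebras. -/
def BAlg.incl : BAlg.{u} ⥤ BAl.{u} where
  obj A := A.toBAl
  map f := f.1

/-! ### Weighted sets -/

/-- A weighted set: a set with a nonnegative real-valued weight function. -/
structure WSet : Type (u + 1) where
  carrier : Type u
  w : carrier → ℝ
  w_nonneg : ∀ x, 0 ≤ w x

/-- Morphisms of weighted sets are the functions that do not increase the weight. -/
instance : Category.{u} WSet.{u} where
  Hom X Y := {f : X.carrier → Y.carrier // ∀ x, Y.w (f x) ≤ X.w x}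
  id _ := ⟨fun x => x, fun _ => le_rfl⟩
  comp f g := ⟨fun x => g.1 (f.1 x), fun x => (g.2 _).trans (f.2 x)⟩

/-- The forgetful functor `A ↦ (A, ‖·‖)` from bounded archimedean algebras to weighted sets. -/
noncomputable def BAl.toWSet : BAl.{u} ⥤ WSet.{u} where
  obj A := ⟨A, lnorm, lnorm_nonneg⟩
  map {A _} f := ⟨LHom.toAlgHom f, lnorm_map_le A.bounded f⟩

/-- The forgetful functor `A ↦ (A, ‖·‖)` from basic algebras to weighted sets. -/
noncomputable def BAlg.toWSet : BAlg.{u} ⥤ WSet.{u} := BAlg.incl ⋙ BAl.toWSet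

/-! ### Canonical extensions -/

/-- `e : A → C` is a canonical extension of the bounded archimedean algebra `A`: `C` is a basic
algebra and `e` is an injective homomorphism (monomorphism) that is dense and compact. -/
structure IsCanonicalExtension {A : BAl.{u}} {C : BAlg.{u}} (e : LHom A C.toBAl) : Prop where
  injective : Function.Injective e
  /-- Each element of `C` is a join of meets of elements of the image of `e`. -/
  dense : ∀ x : C.toBAl, ∃ M : Set C.toBAl,
    (∀ m ∈ M, ∃ S : Set A, IsGLB (e '' S) m) ∧ IsLUB M x
  /-- If `⋀ e[S] + ε ≤ ⋁ e[T]`, then `⋀ e[S'] ≤ ⋁ e[T']` for some finite `S' ⊆ S`, `T' ⊆ T`. -/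
  compact : ∀ (S T : Set A), S.Nonempty → T.Nonempty → ∀ ε : ℝ, 0 < ε →
    ∀ s t : C.toBAl, IsGLB (e '' S) s → IsLUB (e '' T) t → s + ε • (1 : C.toBAl) ≤ t →
      ∃ (S' T' : Finset A) (hS : S'.Nonempty) (hT : T'.Nonempty),
        (S' : Set A) ⊆ S ∧ (T' : Set A) ⊆ T ∧ S'.inf' hS e ≤ T'.sup' hT e

/-! ### Quotients by `ℓ`-ideals -/

/-- An ideal `J` is an `ℓ`-ideal if `|a| ≤ |b|` and `b ∈ J` imply `a ∈ J`. -/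
class IsLIdeal {A : Type u} [LAlgebra A] (J : Ideal A) : Prop where
  solid : ∀ {a b : A}, |a| ≤ |b| → b ∈ J → a ∈ J

section quotient

variable {A : Type u} [LAlgebra A] (J : Ideal A)

theorem IsLIdeal.sup_sub_sup_mem [IsLIdeal J] {a a' b b' : A} (ha : a - a' ∈ J) (hb : b - b' ∈ J) :
    a ⊔ b - a' ⊔ b' ∈ J := by
  have h1 : a ⊔ b - a' ⊔ b ∈ J := IsLIdeal.solid (abs_sup_sub_sup_le_abs a a' b) ha
  have h2 : b ⊔ a' - b' ⊔ a' ∈ J := IsLIdeal.solid (abs_sup_sub_sup_le_abs b b' a') hb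
  rw [sup_comm b, sup_comm b'] at h2
  simpa using J.add_mem h1 h2

theorem IsLIdeal.inf_sub_inf_mem [IsLIdeal J] {a a' b b' : A} (ha : a - a' ∈ J) (hb : b - b' ∈ J) :
    a ⊓ b - a' ⊓ b' ∈ J := by
  have h1 : a ⊓ b - a' ⊓ b ∈ J := IsLIdeal.solid (abs_inf_sub_inf_le_abs a a' b) ha
  have h2 : b ⊓ a' - b' ⊓ a' ∈ J := IsLIdeal.solid (abs_inf_sub_inf_le_abs b b' a') hb
  rw [inf_comm b, inf_comm b'] at h2
  simpa using J.add_mem h1 h2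

/-- The lattice structure on the quotient by an `ℓ`-ideal: `[a] ⊔ [b] = [a ⊔ b]`,
`[a] ⊓ [b] = [a ⊓ b]`, and `[a] ≤ [b]` means `[a] ⊔ [b] = [b]`. -/
instance quotLattice [IsLIdeal J] : Lattice (A ⧸ J) :=
  letI : Max (A ⧸ J) := ⟨Quotient.map₂ (· ⊔ ·) fun a a' ha b b' hb =>
    (Submodule.quotientRel_def J).2 (IsLIdeal.sup_sub_sup_mem J
      ((Submodule.quotientRel_def J).1 ha) ((Submodule.quotientRel_def J).1 hb))⟩
  letI : Min (A ⧸ J) := ⟨Quotient.map₂ (· ⊓ ·) fun a a' ha b b' hb =>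
    (Submodule.quotientRel_def J).2 (IsLIdeal.inf_sub_inf_mem J
      ((Submodule.quotientRel_def J).1 ha) ((Submodule.quotientRel_def J).1 hb))⟩
  Lattice.mk'
    (by rintro ⟨a⟩ ⟨b⟩; exact congrArg (Ideal.Quotient.mk J) (sup_comm a b))
    (by rintro ⟨a⟩ ⟨b⟩ ⟨c⟩; exact congrArg (Ideal.Quotient.mk J) (sup_assoc a b c))
    (by rintro ⟨a⟩ ⟨b⟩; exact congrArg (Ideal.Quotient.mk J) (inf_comm a b))
    (by rintro ⟨a⟩ ⟨b⟩ ⟨c⟩; exact congrArg (Ideal.Quotient.mk J) (inf_assoc a b c))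
    (by rintro ⟨a⟩ ⟨b⟩; exact congrArg (Ideal.Quotient.mk J) (sup_inf_self (a := a) (b := b)))
    (by rintro ⟨a⟩ ⟨b⟩; exact congrArg (Ideal.Quotient.mk J) (inf_sup_self (a := a) (b := b)))

theorem mk_sup [IsLIdeal J] (a b : A) :
    Ideal.Quotient.mk J (a ⊔ b) = Ideal.Quotient.mk J a ⊔ Ideal.Quotient.mk J b := rfl

theorem mk_inf [IsLIdeal J] (a b : A) :
    Ideal.Quotient.mk J (a ⊓ b) = Ideal.Quotient.mk J a ⊓ Ideal.Quotient.mk J b := rfl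

theorem mk_le_mk_of_le [IsLIdeal J] {a b : A} (h : a ≤ b) :
    Ideal.Quotient.mk J a ≤ Ideal.Quotient.mk J b := by
  rw [← sup_eq_right, ← mk_sup, sup_eq_right.2 h]

theorem exists_nonneg_rep [IsLIdeal J] {x : A ⧸ J} (h : 0 ≤ x) :
    ∃ a : A, 0 ≤ a ∧ Ideal.Quotient.mk J a = x := by
  obtain ⟨a, rfl⟩ := Ideal.Quotient.mk_surjective x
  refine ⟨0 ⊔ a, le_sup_left, ?_⟩
  rw [mk_sup, map_zero, sup_eq_right.2 h]

instance quotIsOrderedAddMonoid [IsLIdeal J] : IsOrderedAddMonoid (A ⧸ J) where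
  add_le_add_left x y h z := by
    obtain ⟨a, rfl⟩ := Ideal.Quotient.mk_surjective x
    obtain ⟨b, rfl⟩ := Ideal.Quotient.mk_surjective y
    obtain ⟨c, rfl⟩ := Ideal.Quotient.mk_surjective z
    rw [← sup_eq_right] at h ⊢
    rw [← map_add, ← map_add, ← mk_sup, ← sup_add, map_add, mk_sup, h, map_add]

/-- The quotient of a lattice-ordered algebra by an `ℓ`-ideal. -/
instance quotLAlgebra [IsLIdeal J] : LAlgebra (A ⧸ J) :=
  letI : ZeroLEOneClass (A ⧸ J) := ⟨by
    rw [← map_zero (Ideal.Quotient.mk J), ← map_one (Ideal.Quotient.mk J)]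
    exact mk_le_mk_of_le J zero_le_one⟩
  letI : IsOrderedRing (A ⧸ J) := .of_mul_nonneg fun x y hx hy => by
    obtain ⟨a, ha, rfl⟩ := exists_nonneg_rep J hx
    obtain ⟨b, hb, rfl⟩ := exists_nonneg_rep J hy
    rw [← map_mul, ← map_zero (Ideal.Quotient.mk J)]
    exact mk_le_mk_of_le J (mul_nonneg ha hb)
  letI : IsOrderedModule ℝ (A ⧸ J) := .of_smul_nonneg fun r hr x hx => by
    obtain ⟨a, ha, rfl⟩ := exists_nonneg_rep J hx
    rw [← map_zero (Ideal.Quotient.mk J)]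
    exact mk_le_mk_of_le J (smul_nonneg hr ha)
  { }

theorem mk_le_mk_iff [IsLIdeal J] {a b : A} :
    Ideal.Quotient.mk J a ≤ Ideal.Quotient.mk J b ↔ a ⊔ b - b ∈ J := by
  rw [← sup_eq_right, ← mk_sup, Ideal.Quotient.eq]

/-- The projection onto the quotient by an `ℓ`-ideal. -/
def quotMk [IsLIdeal J] : LHom A (A ⧸ J) :=
  ⟨Ideal.Quotient.mkₐ ℝ J, fun _ _ => rfl, fun _ _ => rfl⟩

/-- An ideal is an archimedean `ℓ`-ideal if it is an `ℓ`-ideal with archimedean quotient. -/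
def IsArchIdeal : Prop := ∃ _ : IsLIdeal J, IsArch (A ⧸ J)

theorem IsArchIdeal.mem {J : Ideal A} (hJ : IsArchIdeal J) {a b : A}
    (h : ∀ n : ℕ, (n • a) ⊔ b - b ∈ J) : a ⊔ 0 - 0 ∈ J := by
  obtain ⟨h1, h2⟩ := hJ
  have := h2 (Ideal.Quotient.mk J a) (Ideal.Quotient.mk J b) fun n => by
    rw [← map_nsmul]
    exact (mk_le_mk_iff J).2 (h n)
  rw [← map_zero (Ideal.Quotient.mk J)] at this
  exact (mk_le_mk_iff J).1 this

/-- The archimedean `ℓ`-ideal generated by a set: the intersection of all archimedean `ℓ`-ideals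
containing it. -/
def archSpan (S : Set A) : Ideal A := sInf {J : Ideal A | IsArchIdeal J ∧ S ⊆ J}

theorem subset_archSpan (S : Set A) : S ⊆ archSpan S := fun _ ha =>
  Submodule.mem_sInf.2 fun _ hJ => hJ.2 ha

theorem archSpan_le {S : Set A} {J : Ideal A} (hJ : IsArchIdeal J) (hS : S ⊆ J) :
    archSpan S ≤ J := sInf_le ⟨hJ, hS⟩

instance archSpan_isLIdeal (S : Set A) : IsLIdeal (archSpan S) where
  solid {_ _} h hb := Submodule.mem_sInf.2 fun J hJ =>
    have := hJ.1.1
    IsLIdeal.solid h (Submodule.mem_sInf.1 hb J hJ)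

theorem isArch_quot_archSpan (S : Set A) : IsArch (A ⧸ archSpan S) := by
  intro x y h
  obtain ⟨a, rfl⟩ := Ideal.Quotient.mk_surjective x
  obtain ⟨b, rfl⟩ := Ideal.Quotient.mk_surjective y
  rw [← map_zero (Ideal.Quotient.mk _)]
  refine (mk_le_mk_iff (archSpan S)).2 (Submodule.mem_sInf.2 fun J hJ =>
    hJ.1.mem (b := b) fun n => ?_)
  have h' := h n
  rw [← map_nsmul] at h'
  exact Submodule.mem_sInf.1 ((mk_le_mk_iff (archSpan S)).1 h') J hJ

end quotient

section ker

variable {A B : Type u} [LAlgebra A] [LAlgebra B]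

/-- The kernel of a homomorphism into an archimedean algebra is an archimedean `ℓ`-ideal. -/
theorem isArchIdeal_ker (hB : IsArch B) (f : LHom A B) :
    IsArchIdeal (RingHom.ker f.toAlgHom) := by
  have h1 : IsLIdeal (RingHom.ker f.toAlgHom) := by
    refine ⟨fun {a b} h hb => ?_⟩
    rw [RingHom.mem_ker] at hb ⊢
    have := f.mono h
    rw [f.map_abs, f.map_abs, hb, abs_zero] at this
    exact le_antisymm ((le_abs_self _).trans this)
      (neg_nonpos.1 ((neg_le_abs _).trans this))
  have h2 : ∀ a b : A, Ideal.Quotient.mk (RingHom.ker f.toAlgHom) a ≤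
      Ideal.Quotient.mk (RingHom.ker f.toAlgHom) b ↔ f a ≤ f b := by
    intro a b
    rw [mk_le_mk_iff, RingHom.mem_ker, map_sub, f.map_sup, sub_eq_zero, sup_eq_right]
  refine ⟨h1, fun x y h => ?_⟩
  obtain ⟨a, rfl⟩ := Ideal.Quotient.mk_surjective x
  obtain ⟨b, rfl⟩ := Ideal.Quotient.mk_surjective y
  rw [← map_zero (Ideal.Quotient.mk _), h2, map_zero]
  refine hB _ (f b) fun n => ?_
  have := h n
  rwa [← map_nsmul, h2, map_nsmul] at this

/-- The homomorphism induced on a quotient. -/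
def quotLift (J : Ideal A) [IsLIdeal J] (f : LHom A B) (h : ∀ a ∈ J, f a = 0) :
    LHom (A ⧸ J) B where
  toAlgHom := Ideal.Quotient.liftₐ J f.toAlgHom h
  map_sup x y := by
    obtain ⟨a, rfl⟩ := Ideal.Quotient.mk_surjective x
    obtain ⟨b, rfl⟩ := Ideal.Quotient.mk_surjective y
    exact f.map_sup a b
  map_inf x y := by
    obtain ⟨a, rfl⟩ := Ideal.Quotient.mk_surjective x
    obtain ⟨b, rfl⟩ := Ideal.Quotient.mk_surjective y
    exact f.map_inf a b

end ker

/-! ### The free lattice-ordered algebra on a set -/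

/-- Terms in the signature of lattice-ordered algebras with variables in `X`. -/
inductive Term (X : Type u) : Type u
  | var : X → Term X
  | zero : Term X
  | one : Term X
  | add : Term X → Term X → Term X
  | neg : Term X → Term X
  | mul : Term X → Term X → Term X
  | smul : ℝ → Term X → Term X
  | sup : Term X → Term X → Term X
  | inf : Term X → Term X → Term X

/-- The value of a term under an assignment of the variables. -/
def Term.eval {X : Type u} {A : Type u} [LAlgebra A] (v : X → A) : Term X → A
  | var x => v x
  | zero => 0
  | one => 1
  | add s t => s.eval v + t.eval v
  | neg s => -s.eval v
  | mul s t => s.eval v * t.eval v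
  | smul r s => r • s.eval v
  | sup s t => s.eval v ⊔ t.eval v
  | inf s t => s.eval v ⊓ t.eval v

/-- Two terms are identified if the identity `s = t` holds in every lattice-ordered algebra. -/
def termSetoid (X : Type u) : Setoid (Term X) where
  r s t := ∀ (A : Type u) [LAlgebra A] (v : X → A), s.eval v = t.eval v
  iseqv := ⟨fun _ _ _ _ => rfl, fun h A _ v => (h A v).symm,
    fun h h' A _ v => (h A v).trans (h' A v)⟩

/-- The free lattice-ordered algebra `G(X)` on a set `X`: terms modulo the identities of
lattice-ordered algebras. -/
def FreeLAlg (X : Type u) : Type u := Quotient (termSetoid X)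

namespace FreeLAlg

variable {X : Type u}

/-- The class of a term. -/
def mk (s : Term X) : FreeLAlg X := Quotient.mk (termSetoid X) s

theorem mk_eq {s t : Term X}
    (h : ∀ (A : Type u) [LAlgebra A] (v : X → A), s.eval v = t.eval v) : mk s = mk t :=
  Quotient.sound (s := termSetoid X) h

instance : Zero (FreeLAlg X) := ⟨mk .zero⟩
instance : One (FreeLAlg X) := ⟨mk .one⟩
instance : Add (FreeLAlg X) := ⟨Quotient.map₂ .add fun _ _ h _ _ h' A _ v =>
  congrArg₂ (· + ·) (h A v) (h' A v)⟩
instance : Neg (FreeLAlg X) := ⟨Quotient.map .neg fun _ _ h A _ v =>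
  congrArg (- ·) (h A v)⟩
instance : Mul (FreeLAlg X) := ⟨Quotient.map₂ .mul fun _ _ h _ _ h' A _ v =>
  congrArg₂ (· * ·) (h A v) (h' A v)⟩
instance : SMul ℝ (FreeLAlg X) := ⟨fun r => Quotient.map (.smul r) fun _ _ h A _ v =>
  congrArg (r • ·) (h A v)⟩
instance : Max (FreeLAlg X) := ⟨Quotient.map₂ .sup fun _ _ h _ _ h' A _ v =>
  congrArg₂ (· ⊔ ·) (h A v) (h' A v)⟩
instance : Min (FreeLAlg X) := ⟨Quotient.map₂ .inf fun _ _ h _ _ h' A _ v =>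
  congrArg₂ (· ⊓ ·) (h A v) (h' A v)⟩

instance : CommRing (FreeLAlg X) where
  add_assoc := by rintro ⟨a⟩ ⟨b⟩ ⟨c⟩; exact mk_eq fun A _ v => by simp only [Term.eval, add_assoc]
  zero_add := by rintro ⟨a⟩; exact mk_eq fun A _ v => by simp only [Term.eval, zero_add]
  add_zero := by rintro ⟨a⟩; exact mk_eq fun A _ v => by simp only [Term.eval, add_zero]
  add_comm := by rintro ⟨a⟩ ⟨b⟩; exact mk_eq fun A _ v => by simp only [Term.eval, add_comm]
  left_distrib := by rintro ⟨a⟩ ⟨b⟩ ⟨c⟩; exact mk_eq fun A _ v => by simp only [Term.eval, mul_add]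
  right_distrib := by
    rintro ⟨a⟩ ⟨b⟩ ⟨c⟩; exact mk_eq fun A _ v => by simp only [Term.eval, add_mul]
  zero_mul := by rintro ⟨a⟩; exact mk_eq fun A _ v => by simp only [Term.eval, zero_mul]
  mul_zero := by rintro ⟨a⟩; exact mk_eq fun A _ v => by simp only [Term.eval, mul_zero]
  mul_assoc := by rintro ⟨a⟩ ⟨b⟩ ⟨c⟩; exact mk_eq fun A _ v => by simp only [Term.eval, mul_assoc]
  one_mul := by rintro ⟨a⟩; exact mk_eq fun A _ v => by simp only [Term.eval, one_mul]
  mul_one := by rintro ⟨a⟩; exact mk_eq fun A _ v => by simp only [Term.eval, mul_one]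
  mul_comm := by rintro ⟨a⟩ ⟨b⟩; exact mk_eq fun A _ v => by simp only [Term.eval, mul_comm]
  neg_add_cancel := by
    rintro ⟨a⟩; exact mk_eq fun A _ v => by simp only [Term.eval, neg_add_cancel]
  nsmul := nsmulRec
  zsmul := zsmulRec

instance : Lattice (FreeLAlg X) :=
  Lattice.mk'
    (by rintro ⟨a⟩ ⟨b⟩; exact mk_eq fun A _ v => by simp only [Term.eval, sup_comm])
    (by rintro ⟨a⟩ ⟨b⟩ ⟨c⟩; exact mk_eq fun A _ v => by simp only [Term.eval, sup_assoc])
    (by rintro ⟨a⟩ ⟨b⟩; exact mk_eq fun A _ v => by simp only [Term.eval, inf_comm])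
    (by rintro ⟨a⟩ ⟨b⟩ ⟨c⟩; exact mk_eq fun A _ v => by simp only [Term.eval, inf_assoc])
    (by rintro ⟨a⟩ ⟨b⟩; exact mk_eq fun A _ v => by simp only [Term.eval, sup_inf_self])
    (by rintro ⟨a⟩ ⟨b⟩; exact mk_eq fun A _ v => by simp only [Term.eval, inf_sup_self])

instance : Module ℝ (FreeLAlg X) where
  one_smul := by rintro ⟨a⟩; exact mk_eq fun A _ v => by simp only [Term.eval, one_smul]
  mul_smul := by rintro r s ⟨a⟩; exact mk_eq fun A _ v => by simp only [Term.eval, mul_smul]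
  smul_zero := by rintro r; exact mk_eq fun A _ v => by simp only [Term.eval, smul_zero]
  smul_add := by rintro r ⟨a⟩ ⟨b⟩; exact mk_eq fun A _ v => by simp only [Term.eval, smul_add]
  add_smul := by rintro r s ⟨a⟩; exact mk_eq fun A _ v => by simp only [Term.eval, add_smul]
  zero_smul := by rintro ⟨a⟩; exact mk_eq fun A _ v => by simp only [Term.eval, zero_smul]

instance : Algebra ℝ (FreeLAlg X) :=
  Algebra.ofModule
    (by rintro r ⟨a⟩ ⟨b⟩; exact mk_eq fun A _ v => by simp only [Term.eval, smul_mul_assoc])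
    (by rintro r ⟨a⟩ ⟨b⟩; exact mk_eq fun A _ v => by simp only [Term.eval, mul_smul_comm])

instance : IsOrderedAddMonoid (FreeLAlg X) where
  add_le_add_left := by
    intro a b h c
    rw [← sup_eq_right] at h ⊢
    have h' : (a + c) ⊔ (b + c) = (a ⊔ b) + c := by
      revert a b c
      rintro ⟨a⟩ ⟨b⟩ - ⟨c⟩
      exact mk_eq fun A _ v => by simp only [Term.eval, sup_add]
    exact h'.trans (congrArg (· + c) h)

/-- The free lattice-ordered algebra is a lattice-ordered algebra. -/
instance : LAlgebra (FreeLAlg X) :=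
  letI : ZeroLEOneClass (FreeLAlg X) := ⟨by
    rw [← sup_eq_right]
    exact mk_eq fun A _ v => by simp only [Term.eval]; exact sup_eq_right.2 zero_le_one⟩
  letI : IsOrderedRing (FreeLAlg X) := .of_mul_nonneg <| by
    rintro x y hx hy
    rw [← sup_eq_right] at hx hy ⊢
    rw [← hx, ← hy]
    revert x y
    rintro ⟨a⟩ ⟨b⟩ - -
    exact mk_eq fun A _ v => by
      simp only [Term.eval]
      exact sup_eq_right.2 (mul_nonneg le_sup_left le_sup_left)
  letI : IsOrderedModule ℝ (FreeLAlg X) := .of_smul_nonneg <| by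
    rintro r hr x hx
    rw [← sup_eq_right] at hx ⊢
    rw [← hx]
    revert x
    rintro ⟨a⟩ -
    exact mk_eq fun A _ v => by
      simp only [Term.eval]
      exact sup_eq_right.2 (smul_nonneg hr le_sup_left)
  { }

/-- The generators `g(x)`. -/
def of (x : X) : FreeLAlg X := mk (.var x)

/-- The homomorphism induced by an assignment of the generators. -/
def lift {A : Type u} [LAlgebra A] (v : X → A) : LHom (FreeLAlg X) A where
  toAlgHom := AlgHom.ofLinearMap
    { toFun := Quotient.lift (Term.eval v) fun _ _ h => h A v
      map_add' := by rintro ⟨a⟩ ⟨b⟩; rfl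
      map_smul' := by rintro r ⟨a⟩; rfl }
    rfl (by rintro ⟨a⟩ ⟨b⟩; rfl)
  map_sup := by rintro ⟨a⟩ ⟨b⟩; rfl
  map_inf := by rintro ⟨a⟩ ⟨b⟩; rfl

theorem lift_of {A : Type u} [LAlgebra A] (v : X → A) (x : X) : lift v (of x) = v x := rfl

/-- Homomorphisms agreeing on the generators are equal. -/
theorem hom_ext {A : Type u} [LAlgebra A] {f g : LHom (FreeLAlg X) A}
    (h : ∀ x, f (of x) = g (of x)) : f = g := by
  have key : ∀ t : Term X, f (mk t) = g (mk t) := by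
    intro t
    induction t with
    | var x => exact h x
    | zero => exact (map_zero f.toAlgHom).trans (map_zero g.toAlgHom).symm
    | one => exact (map_one f.toAlgHom).trans (map_one g.toAlgHom).symm
    | add s t hs ht =>
      exact (map_add f.toAlgHom (mk s) (mk t)).trans
        ((congrArg₂ (· + ·) hs ht).trans (map_add g.toAlgHom (mk s) (mk t)).symm)
    | neg s hs =>
      exact (map_neg f.toAlgHom (mk s)).trans
        ((congrArg (- ·) hs).trans (map_neg g.toAlgHom (mk s)).symm)
    | mul s t hs ht =>
      exact (map_mul f.toAlgHom (mk s) (mk t)).trans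
        ((congrArg₂ (· * ·) hs ht).trans (map_mul g.toAlgHom (mk s) (mk t)).symm)
    | smul r s hs =>
      exact (map_smul f.toAlgHom r (mk s)).trans
        ((congrArg (r • ·) hs).trans (map_smul g.toAlgHom r (mk s)).symm)
    | sup s t hs ht =>
      exact (f.map_sup (mk s) (mk t)).trans
        ((congrArg₂ (· ⊔ ·) hs ht).trans (g.map_sup (mk s) (mk t)).symm)
    | inf s t hs ht =>
      exact (f.map_inf (mk s) (mk t)).trans
        ((congrArg₂ (· ⊓ ·) hs ht).trans (g.map_inf (mk s) (mk t)).symm)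
  apply LHom.ext
  apply AlgHom.ext
  rintro ⟨t⟩
  exact key t

end FreeLAlg

/-! ### The free bounded archimedean algebra on a weighted set -/

/-- The truncation `(a ⊔ -w) ⊓ w` of an element at a real level `w`. -/
def trunc {A : Type u} [LAlgebra A] (w : ℝ) (a : A) : A := (a ⊔ -(w • 1)) ⊓ (w • 1)

/-- The archimedean `ℓ`-ideal of `G(X)` generated by the elements
`g(x) - ((g(x) ⊔ -w(x)) ⊓ w(x))`. -/
def relIdeal (W : WSet.{u}) : Ideal (FreeLAlg W.carrier) :=
  archSpan {a | ∃ x, a = FreeLAlg.of x - trunc (W.w x) (FreeLAlg.of x)}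

instance (W : WSet.{u}) : IsLIdeal (relIdeal W) := archSpan_isLIdeal _

/-- The underlying algebra of `F(X, w)`: the quotient of `G(X)` by the ideal `relIdeal`. -/
abbrev FreeCarrier (W : WSet.{u}) : Type u := FreeLAlg W.carrier ⧸ relIdeal W

/-- The image `f(x)` of a generator in `F(X, w)`. -/
def FreeCarrier.of (W : WSet.{u}) (x : W.carrier) : FreeCarrier W :=
  quotMk (relIdeal W) (FreeLAlg.of x)

theorem FreeCarrier.of_mem_bounds (W : WSet.{u}) (x : W.carrier) :
    -(W.w x • 1) ≤ FreeCarrier.of W x ∧ FreeCarrier.of W x ≤ W.w x • 1 := by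
  have h : FreeCarrier.of W x = quotMk (relIdeal W) (trunc (W.w x) (FreeLAlg.of x)) :=
    Ideal.Quotient.eq.2 (subset_archSpan _ ⟨x, rfl⟩)
  have h0 : -(W.w x • (1 : FreeLAlg W.carrier)) ≤ W.w x • 1 :=
    neg_le_self (smul_nonneg (W.w_nonneg x) zero_le_one)
  constructor
  · simpa [h] using (quotMk (relIdeal W)).mono
      (show -(W.w x • 1) ≤ trunc (W.w x) (FreeLAlg.of x) from le_inf le_sup_right h0)
  · simpa [h] using (quotMk (relIdeal W)).mono
      (show trunc (W.w x) (FreeLAlg.of x) ≤ W.w x • 1 from inf_le_right)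

theorem mul_le_of_bounds {A : Type u} [LAlgebra A] {a b : A} {r s : ℝ}
    (ha : -(r • 1) ≤ a) (ha' : a ≤ r • 1) (hb : -(s • 1) ≤ b) (hb' : b ≤ s • 1) :
    a * b ≤ (r * s) • 1 := by
  have h1 : 0 ≤ (r • 1 - a) * (s • 1 + b) :=
    mul_nonneg (sub_nonneg.2 ha') (by rw [add_comm]; exact neg_le_iff_add_nonneg.1 hb)
  have h2 : 0 ≤ (r • 1 + a) * (s • 1 - b) :=
    mul_nonneg (by rw [add_comm]; exact neg_le_iff_add_nonneg.1 ha) (sub_nonneg.2 hb')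
  have h3 : 0 ≤ (1 / 2 : ℝ) • ((r • 1 - a) * (s • 1 + b) + (r • 1 + a) * (s • 1 - b)) :=
    smul_nonneg (by norm_num) (add_nonneg h1 h2)
  have h4 : (1 / 2 : ℝ) • ((r • 1 - a) * (s • 1 + b) + (r • 1 + a) * (s • 1 - b))
      = (r * s) • 1 - a * b := by
    have : (r • 1 - a) * (s • 1 + b) + (r • 1 + a) * (s • 1 - b)
        = (2 : ℝ) • ((r * s) • 1 - a * b) := by
      simp only [Algebra.smul_def, map_mul, mul_one, map_ofNat]
      ring
    rw [this, smul_smul]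
    norm_num
  rw [h4] at h3
  exact sub_nonneg.1 h3

theorem freeCarrier_bounds (W : WSet.{u}) (t : Term W.carrier) : ∃ r : ℝ, 0 ≤ r ∧
    -(r • 1) ≤ quotMk (relIdeal W) (FreeLAlg.mk t) ∧
      quotMk (relIdeal W) (FreeLAlg.mk t) ≤ r • 1 := by
  have hpos : ∀ {r : ℝ}, 0 ≤ r → (0 : FreeCarrier W) ≤ r • 1 :=
    fun hr => smul_nonneg hr zero_le_one
  have hmono : ∀ {r s : ℝ}, r ≤ s → (r • 1 : FreeCarrier W) ≤ s • 1 :=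
    fun h => smul_le_smul_of_nonneg_right h zero_le_one
  induction t with
  | var x => exact ⟨W.w x, W.w_nonneg x, FreeCarrier.of_mem_bounds W x⟩
  | zero =>
    refine ⟨0, le_rfl, ?_⟩
    rw [show quotMk (relIdeal W) (FreeLAlg.mk .zero) = 0 from map_zero _]
    simp
  | one =>
    refine ⟨1, zero_le_one, ?_⟩
    rw [show quotMk (relIdeal W) (FreeLAlg.mk .one) = 1 from map_one _, one_smul]
    exact ⟨neg_le_self zero_le_one, le_rfl⟩
  | add s t hs ht =>
    obtain ⟨r, hr, h1, h2⟩ := hs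
    obtain ⟨r', hr', h1', h2'⟩ := ht
    refine ⟨r + r', add_nonneg hr hr', ?_⟩
    rw [show quotMk (relIdeal W) (FreeLAlg.mk (s.add t)) = quotMk (relIdeal W) (FreeLAlg.mk s) +
      quotMk (relIdeal W) (FreeLAlg.mk t) from
        map_add (quotMk (relIdeal W)).toAlgHom (FreeLAlg.mk s) (FreeLAlg.mk t), add_smul, neg_add]
    exact ⟨add_le_add h1 h1', add_le_add h2 h2'⟩
  | neg s hs =>
    obtain ⟨r, hr, h1, h2⟩ := hs
    refine ⟨r, hr, ?_⟩
    rw [show quotMk (relIdeal W) (FreeLAlg.mk s.neg) = -quotMk (relIdeal W) (FreeLAlg.mk s)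
      from map_neg (quotMk (relIdeal W)).toAlgHom (FreeLAlg.mk s)]
    exact ⟨neg_le_neg h2, neg_le.1 h1⟩
  | mul s t hs ht =>
    obtain ⟨r, hr, h1, h2⟩ := hs
    obtain ⟨r', hr', h1', h2'⟩ := ht
    refine ⟨r * r', mul_nonneg hr hr', ?_⟩
    rw [show quotMk (relIdeal W) (FreeLAlg.mk (s.mul t)) = quotMk (relIdeal W) (FreeLAlg.mk s) *
      quotMk (relIdeal W) (FreeLAlg.mk t) from
        map_mul (quotMk (relIdeal W)).toAlgHom (FreeLAlg.mk s) (FreeLAlg.mk t)]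
    refine ⟨?_, mul_le_of_bounds h1 h2 h1' h2'⟩
    have := mul_le_of_bounds (neg_le_neg h2) (neg_le.1 h1) h1' h2'
    rw [neg_mul] at this
    exact neg_le.1 this
  | smul c s hs =>
    obtain ⟨r, hr, h1, h2⟩ := hs
    refine ⟨|c| * r, mul_nonneg (abs_nonneg c) hr, ?_⟩
    rw [show quotMk (relIdeal W) (FreeLAlg.mk (s.smul c)) =
      c • quotMk (relIdeal W) (FreeLAlg.mk s) from
        map_smul (quotMk (relIdeal W)).toAlgHom c (FreeLAlg.mk s), mul_smul]
    rcases le_total 0 c with hc | hc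
    · rw [abs_of_nonneg hc, ← smul_neg]
      exact ⟨smul_le_smul_of_nonneg_left h1 hc, smul_le_smul_of_nonneg_left h2 hc⟩
    · rw [abs_of_nonpos hc, ← smul_neg]
      have hc' : 0 ≤ -c := neg_nonneg.2 hc
      have e1 := smul_le_smul_of_nonneg_left (neg_le_neg h2) hc'
      have e2 := smul_le_smul_of_nonneg_left (neg_le.1 h1) hc'
      simp only [smul_neg, neg_smul, neg_neg] at e1 e2 ⊢
      exact ⟨e1, e2⟩
  | sup s t hs ht =>
    obtain ⟨r, hr, h1, h2⟩ := hs
    obtain ⟨r', hr', h1', h2'⟩ := ht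
    refine ⟨max r r', le_max_of_le_left hr, ?_⟩
    rw [show quotMk (relIdeal W) (FreeLAlg.mk (s.sup t)) = quotMk (relIdeal W) (FreeLAlg.mk s) ⊔
      quotMk (relIdeal W) (FreeLAlg.mk t) from
        (quotMk (relIdeal W)).map_sup (FreeLAlg.mk s) (FreeLAlg.mk t)]
    exact ⟨(neg_le_neg (hmono (le_max_left r r'))).trans (h1.trans le_sup_left),
      sup_le (h2.trans (hmono (le_max_left _ _))) (h2'.trans (hmono (le_max_right _ _)))⟩
  | inf s t hs ht =>
    obtain ⟨r, hr, h1, h2⟩ := hs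
    obtain ⟨r', hr', h1', h2'⟩ := ht
    refine ⟨max r r', le_max_of_le_left hr, ?_⟩
    rw [show quotMk (relIdeal W) (FreeLAlg.mk (s.inf t)) = quotMk (relIdeal W) (FreeLAlg.mk s) ⊓
      quotMk (relIdeal W) (FreeLAlg.mk t) from
        (quotMk (relIdeal W)).map_inf (FreeLAlg.mk s) (FreeLAlg.mk t)]
    exact ⟨le_inf ((neg_le_neg (hmono (le_max_left r r'))).trans h1)
      ((neg_le_neg (hmono (le_max_right r r'))).trans h1'),
      inf_le_left.trans (h2.trans (hmono (le_max_left _ _)))⟩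

/-- The algebra `F(X, w)`. -/
def freeObj (W : WSet.{u}) : BAl.{u} where
  carrier := FreeCarrier W
  str := quotLAlgebra (relIdeal W)
  bounded a := by
    obtain ⟨⟨t⟩, rfl⟩ := Ideal.Quotient.mk_surjective a
    obtain ⟨r, -, -, h⟩ := freeCarrier_bounds W t
    obtain ⟨n, hn⟩ := exists_nat_ge r
    refine ⟨n, h.trans ?_⟩
    rw [← Nat.cast_smul_eq_nsmul ℝ]
    exact smul_le_smul_of_nonneg_right hn zero_le_one
  arch := isArch_quot_archSpan _

/-- The map `f : (X, w) → F(X, w)`, as a morphism of weighted sets. -/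
noncomputable def freeUnit (W : WSet.{u}) : W ⟶ BAl.toWSet.obj (freeObj W) :=
  ⟨FreeCarrier.of W, fun x => lnorm_le (W.w_nonneg x)
    (abs_le'.2 ⟨(FreeCarrier.of_mem_bounds W x).2, neg_le.1 (FreeCarrier.of_mem_bounds W x).1⟩)⟩

/-- The homomorphism `F(X, w) → A` extending a morphism of weighted sets `(X, w) → A`. -/
noncomputable def freeLift {W : WSet.{u}} {A : BAl.{u}} (h : W ⟶ BAl.toWSet.obj A) :
    freeObj W ⟶ A :=
  let hv : W.carrier → A := h.1
  quotLift (A := FreeLAlg W.carrier) (B := A) (relIdeal W) (FreeLAlg.lift hv) fun a ha =>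
    archSpan_le (isArchIdeal_ker A.arch (FreeLAlg.lift hv)) (by
      rintro _ ⟨x, rfl⟩
      have hx : |hv x| ≤ W.w x • (1 : A) :=
        (abs_le_lnorm A.bounded A.arch _).trans
          (smul_le_smul_of_nonneg_right (h.2 x) zero_le_one)
      have h1 : hv x ≤ W.w x • (1 : A) := (le_abs_self _).trans hx
      have h2 : -(W.w x • (1 : A)) ≤ hv x := neg_le.1 ((neg_le_abs _).trans hx)
      refine RingHom.mem_ker.2 ?_
      rw [map_sub, trunc, LHom.map_inf, LHom.map_sup, map_neg, map_smul, map_one,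
        FreeLAlg.lift_of, sup_eq_left.2 h2, inf_eq_left.2 h1, sub_self]) ha

theorem freeUnit_freeLift {W : WSet.{u}} {A : BAl.{u}} (h : W ⟶ BAl.toWSet.obj A) :
    freeUnit W ≫ BAl.toWSet.map (freeLift h) = h := rfl

theorem free_hom_ext {W : WSet.{u}} {A : BAl.{u}} {p q : freeObj W ⟶ A}
    (h : freeUnit W ≫ BAl.toWSet.map p = freeUnit W ≫ BAl.toWSet.map q) : p = q := by
  have e : LHom.comp (show LHom (FreeCarrier W) A from p) (quotMk (relIdeal W)) =
      LHom.comp (show LHom (FreeCarrier W) A from q) (quotMk (relIdeal W)) :=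
    FreeLAlg.hom_ext fun x => congrFun (congrArg Subtype.val h) x
  apply LHom.ext
  apply AlgHom.ext
  intro a
  obtain ⟨a, rfl⟩ := Ideal.Quotient.mk_surjective a
  exact DFunLike.congr_fun (congrArg LHom.toAlgHom e) a

/-- The functor `(X, w) ↦ F(X, w)`; on a morphism `h`, it is the unique homomorphism with
`F(h) ∘ f = f ∘ h`. -/
noncomputable def freeBAl : WSet.{u} ⥤ BAl.{u} where
  obj := freeObj
  map h := freeLift (h ≫ freeUnit _)
  map_id W := free_hom_ext (by rw [freeUnit_freeLift]; rfl)
  map_comp {U V W} h k := free_hom_ext (by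
    rw [freeUnit_freeLift, Functor.map_comp, ← Category.assoc (freeUnit U), freeUnit_freeLift,
      Category.assoc, Category.assoc, freeUnit_freeLift])

end WeightedFree

namespace WeightedFree

/-! The left adjoint sends `(X, w)` to the algebra of all bounded functions, with no continuity
required, on the compact box `∏ [-w x, w x]`. Two representation theorems carry the proof.

Points: by Zorn, every proper `ℓ`-ideal lies in a maximal one, and the quotient by a maximal one is
`ℝ`. Hence real-valued homomorphisms determine the order of a bounded archimedean algebra
(`le_of_forall_point`). A point of `F(X, w)` is evaluation at a point of the box, so `F(X, w)`
embeds into the functions on the box (`Box.rep_injective`), with continuous image. Density holds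
because the characteristic bump of a single point is a meet of tent functions in the coordinates;
compactness is Tychonoff's theorem.

Atoms: in a basic algebra `C`, multiplication by an atomic idempotent `z` turns each element into a
real multiple of `z`. These multiples are the values of a point, and together they identify `C` with
the bounded functions on its atoms (`le_of_forall_atomPoint`, `exists_atomPoint_eq`). A weighted map
from `(X, w)` to `C` therefore assigns a point of the box to each atom of `C`, and pulling back
along this assignment is a normal homomorphism. It is the only one extending the given map, since
density makes a normal homomorphism determined by its values on `F(X, w)`, hence on generators. -/

/-! ### Points of a bounded archimedean algebra -/

/-- A real-valued homomorphism of lattice-ordered algebras. -/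
structure Point (A : Type u) [LAlgebra A] where
  toAlgHom : A →ₐ[ℝ] ℝ
  map_sup : ∀ a b, toAlgHom (a ⊔ b) = toAlgHom a ⊔ toAlgHom b
  map_inf : ∀ a b, toAlgHom (a ⊓ b) = toAlgHom a ⊓ toAlgHom b

section points

variable {A : Type u} [LAlgebra A]

instance : CoeFun (Point A) (fun _ => A → ℝ) := ⟨fun p => p.toAlgHom⟩

theorem Point.mono (p : Point A) {a b : A} (h : a ≤ b) : p a ≤ p b := by
  rw [← sup_eq_right, ← p.map_sup, sup_eq_right.2 h]

/-- Products of nonnegative elements give it: `(|a| - a)(|b| + b) + (|a| + a)(|b| - b) = 2(|a||b| -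
ab)`. -/
theorem abs_mul_le (a b : A) : |a * b| ≤ |a| * |b| := by
  have key : ∀ a b : A, a * b ≤ |a| * |b| := by
    intro a b
    have h1 : 0 ≤ (|a| - a) * (|b| + b) :=
      mul_nonneg (sub_nonneg.2 (le_abs_self a)) (neg_le_iff_add_nonneg.1 (neg_le_abs b))
    have h2 : 0 ≤ (|a| + a) * (|b| - b) :=
      mul_nonneg (neg_le_iff_add_nonneg.1 (neg_le_abs a)) (sub_nonneg.2 (le_abs_self b))
    have h3 : 0 ≤ (1 / 2 : ℝ) • ((|a| - a) * (|b| + b) + (|a| + a) * (|b| - b)) :=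
      smul_nonneg (by norm_num) (add_nonneg h1 h2)
    have h4 : (|a| - a) * (|b| + b) + (|a| + a) * (|b| - b) = (2 : ℝ) • (|a| * |b| - a * b) := by
      simp only [Algebra.smul_def, map_ofNat]
      ring
    rw [h4, smul_smul] at h3
    norm_num at h3
    exact h3
  refine abs_le'.2 ⟨key a b, ?_⟩
  have := key (-a) b
  rwa [neg_mul, abs_neg] at this

theorem IsLIdeal.abs_mem {J : Ideal A} [IsLIdeal J] {a : A} (h : a ∈ J) : |a| ∈ J :=
  IsLIdeal.solid (abs_abs a).le h

/-- The `ℓ`-ideal generated by an `ℓ`-ideal and a nonnegative element. -/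
def adjoin (hA : IsBounded A) (J : Ideal A) (x : A) : Ideal A where
  carrier := {z | ∃ m ∈ J, 0 ≤ m ∧ ∃ n : ℕ, |z| ≤ m + n • x}
  zero_mem' := ⟨0, J.zero_mem, le_rfl, 0, by simp⟩
  add_mem' := by
    rintro a b ⟨m, hm, hm0, n, h⟩ ⟨m', hm', hm0', n', h'⟩
    refine ⟨m + m', J.add_mem hm hm', add_nonneg hm0 hm0', n + n', ?_⟩
    refine (abs_add_le a b).trans ((add_le_add h h').trans_eq ?_)
    rw [add_smul]
    abel
  smul_mem' := by
    rintro c a ⟨m, hm, hm0, n, h⟩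
    -- Boundedness replaces the multiplier `|c|` by a natural number, so that the bound keeps the
    -- form `m + n • x`.
    obtain ⟨k, hk⟩ := hA |c|
    refine ⟨k • m, J.nsmul_mem hm k, nsmul_nonneg hm0 k, k * n, ?_⟩
    calc |c • a| ≤ |c| * |a| := abs_mul_le c a
      _ ≤ (k • 1) * |a| := mul_le_mul_of_nonneg_right hk (abs_nonneg a)
      _ = k • |a| := by rw [smul_mul_assoc, one_mul]
      _ ≤ k • (m + n • x) := nsmul_le_nsmul_right h k
      _ = k • m + (k * n) • x := by rw [smul_add, mul_smul]

theorem adjoin_isLIdeal (hA : IsBounded A) (J : Ideal A) (x : A) :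
    IsLIdeal (adjoin hA J x) where
  solid := by
    rintro a b h ⟨m, hm, hm0, n, h'⟩
    exact ⟨m, hm, hm0, n, h.trans h'⟩

theorem le_adjoin (hA : IsBounded A) (J : Ideal A) [IsLIdeal J] (x : A) :
    J ≤ adjoin hA J x := fun a ha =>
  ⟨|a|, IsLIdeal.abs_mem ha, abs_nonneg a, 0, by simp⟩

theorem mem_adjoin (hA : IsBounded A) (J : Ideal A) (x : A) (hx : 0 ≤ x) :
    x ∈ adjoin hA J x :=
  ⟨0, J.zero_mem, le_rfl, 1, by rw [abs_of_nonneg hx]; simp⟩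

theorem exists_maximal_lIdeal (J : Ideal A) [IsLIdeal J] (h1 : (1 : A) ∉ J) :
    ∃ M : Ideal A, J ≤ M ∧ Maximal (fun K : Ideal A => IsLIdeal K ∧ (1 : A) ∉ K) M := by
  refine zorn_le_nonempty₀ {K : Ideal A | IsLIdeal K ∧ (1 : A) ∉ K} ?_ J ⟨‹_›, h1⟩
  intro c hc hchain K hK
  have hmem : ∀ {a : A}, a ∈ sSup c ↔ ∃ K ∈ c, a ∈ K := fun {a} =>
    Submodule.mem_sSup_of_directed ⟨K, hK⟩ hchain.directedOn
  refine ⟨sSup c, ⟨⟨fun {a b} h hb => ?_⟩, fun h => ?_⟩, fun K hK => le_sSup hK⟩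
  · obtain ⟨K, hK, hb⟩ := hmem.1 hb
    have := (hc hK).1
    exact hmem.2 ⟨K, hK, IsLIdeal.solid h hb⟩
  · obtain ⟨K, hK, h⟩ := hmem.1 h
    exact (hc hK).2 h

/-! ### Maximal `ℓ`-ideals and their real quotients -/

section maximal

variable {M : Ideal A} (hM : Maximal (fun K : Ideal A => IsLIdeal K ∧ (1 : A) ∉ K) M)

include hM

/-- This is the usable form of maximality: adjoining `x` to `M` must produce `1`. -/
theorem exists_one_le_of_notMem (hA : IsBounded A) {x : A} (hx : 0 ≤ x) (h : x ∉ M) :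
    ∃ m ∈ M, 0 ≤ m ∧ ∃ n : ℕ, 1 ≤ m + n • x := by
  have := hM.1.1
  by_contra h1
  have h2 : (1 : A) ∉ adjoin hA M x := by
    rintro ⟨m, hm, hm0, n, h⟩
    exact h1 ⟨m, hm, hm0, n, (le_abs_self _).trans h⟩
  exact h (hM.2 ⟨adjoin_isLIdeal hA M x, h2⟩ (le_adjoin hA M x) (mem_adjoin hA M x hx))

theorem mem_of_nonneg_of_le {a b : A} (ha : 0 ≤ a) (h : a ≤ b) (hb : b ∈ M) : a ∈ M := by
  have := hM.1.1
  exact IsLIdeal.solid (by rwa [abs_of_nonneg ha, abs_of_nonneg (ha.trans h)]) hb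

/-- If both were outside `M`, a common `u ∈ M` and `k` would satisfy `1 ≤ u + k • x` and `1 ≤ u + k
• y`, hence `1 ≤ u + (k • x ⊓ k • y) = u`. Applied to positive and negative parts, this makes the
quotient by `M` totally ordered. -/
theorem mem_or_mem_of_inf_eq_zero (hA : IsBounded A) {x y : A} (h : x ⊓ y = 0) :
    x ∈ M ∨ y ∈ M := by
  have hx : 0 ≤ x := h ▸ inf_le_left
  have hy : 0 ≤ y := h ▸ inf_le_right
  by_contra! hxy
  obtain ⟨m, hm, hm0, n, h1⟩ := exists_one_le_of_notMem hM hA hx hxy.1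
  obtain ⟨m', hm', hm0', n', h1'⟩ := exists_one_le_of_notMem hM hA hy hxy.2
  refine hM.1.2 (mem_of_nonneg_of_le hM zero_le_one ?_ (M.add_mem hm hm'))
  have h2 : 1 ≤ (m + m') + (n + n') • x := h1.trans
    (add_le_add (le_add_of_nonneg_right hm0') (nsmul_le_nsmul_left hx (Nat.le_add_right _ _)))
  have h3 : 1 ≤ (m + m') + (n + n') • y := h1'.trans
    (add_le_add (le_add_of_nonneg_left hm0) (nsmul_le_nsmul_left hy (Nat.le_add_left _ _)))
  have h4 : (1 : A) ≤ ((m + m') + (n + n') • x) ⊓ ((m + m') + (n + n') • y) := le_inf h2 h3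
  have h5 : ((n + n') • x) ⊓ ((n + n') • y) = 0 := by
    generalize n + n' = k
    -- Disjointness survives multiples because `((k + 1) • a) ⊓ b ≤ (k • a) ⊓ b + a ⊓ b`; it is used
    -- once on each side.
    have key : ∀ a b : A, 0 ≤ b → a ⊓ b = 0 → ∀ k : ℕ, (k • a) ⊓ b ≤ 0 := by
      intro a b hb h k
      have ha : 0 ≤ a := h ▸ inf_le_left
      induction k with
      | zero => simp
      | succ k ih =>
        have e1 : ((k + 1) • a) ⊓ b ≤ (k • a) ⊓ b + a ⊓ b := by
          rw [add_inf, inf_add, inf_add, succ_nsmul]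
          refine le_inf (le_inf inf_le_left (inf_le_right.trans (le_add_of_nonneg_right ha)))
            (le_inf (inf_le_right.trans (le_add_of_nonneg_left (nsmul_nonneg ha k)))
              (inf_le_right.trans (le_add_of_nonneg_right hb)))
        refine e1.trans ?_
        rw [h, add_zero]
        exact ih
    have e1 : (k • x) ⊓ y = 0 := le_antisymm (key x y hy h k) (le_inf (nsmul_nonneg hx k) hy)
    refine le_antisymm ?_ (le_inf (nsmul_nonneg hx k) (nsmul_nonneg hy k))
    rw [inf_comm]
    exact key y _ (nsmul_nonneg hx k) (by rw [inf_comm, e1]) k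
  rwa [← add_inf, h5, add_zero] at h4

theorem smul_one_notMem {r : ℝ} (hr : r ≠ 0) : r • (1 : A) ∉ M := fun h =>
  hM.1.2 (by simpa [smul_smul, hr] using Submodule.smul_of_tower_mem M r⁻¹ h)

/-- The real number is a Dedekind cut: the infimum of those `r` for which the class of `a` modulo
`M` is at most `r`. The class of `a` differs from it by an infinitesimal, and maximality excludes
nonzero infinitesimals. -/
theorem exists_sub_smul_one_mem (hA : IsBounded A) (a : A) : ∃ r : ℝ, a - r • (1 : A) ∈ M := by
  have := hM.1.1
  let S : Set ℝ := {r | (a - r • (1 : A)) ⊔ 0 ∈ M}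
  have hdich : ∀ r : ℝ, r ∈ S ∨ (r • (1 : A) - a) ⊔ 0 ∈ M := fun r => by
    refine mem_or_mem_of_inf_eq_zero hM hA ?_
    have := posPart_inf_negPart_eq_zero (a - r • (1 : A))
    rwa [posPart_def, negPart_def, neg_sub] at this
  have hne : S.Nonempty := by
    obtain ⟨n, hn⟩ := hA a
    refine ⟨n, ?_⟩
    have : (a - (n : ℝ) • (1 : A)) ⊔ 0 = 0 := by
      rw [sup_eq_right, Nat.cast_smul_eq_nsmul]
      exact sub_nonpos.2 hn
    change _ ∈ M
    rw [this]
    exact M.zero_mem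
  have hbdd : BddBelow S := by
    obtain ⟨n, hn⟩ := hA (-a)
    refine ⟨-n, fun r (hr : _ ∈ M) => ?_⟩
    by_contra! h
    refine smul_one_notMem hM (show (-n - r : ℝ) ≠ 0 by linarith) (mem_of_nonneg_of_le hM
      (smul_nonneg (by linarith) zero_le_one) (le_sup_of_le_left ?_) hr)
    rw [sub_smul, neg_smul, Nat.cast_smul_eq_nsmul]
    exact sub_le_sub_right (neg_le.1 hn) _
  refine ⟨sInf S, ?_⟩
  set s := sInf S
  have hup : ∀ ε : ℝ, 0 < ε → (a - (s + ε) • (1 : A)) ⊔ 0 ∈ M := by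
    intro ε hε
    obtain ⟨r, hr, hr'⟩ := exists_lt_of_csInf_lt hne (show sInf S < s + ε by simp [s, hε])
    refine mem_of_nonneg_of_le hM le_sup_right (sup_le_sup_right (sub_le_sub_left ?_ _) _) hr
    exact smul_le_smul_of_nonneg_right hr'.le zero_le_one
  have hlow : ∀ ε : ℝ, 0 < ε → ((s - ε) • (1 : A) - a) ⊔ 0 ∈ M := fun ε hε =>
    (hdich (s - ε)).resolve_left fun h => by
      have := csInf_le hbdd h
      linarith
  by_contra hns
  have habs : |a - s • (1 : A)| ∉ M := fun h => hns (IsLIdeal.solid (abs_abs _).ge h)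
  obtain ⟨m, hm, hm0, n, h1⟩ := exists_one_le_of_notMem hM hA (abs_nonneg _) habs
  -- This choice gives `n * ε < 1`, so `1 ≤ m + n • |a - s|` with `|a - s| ≤ u + ε` and `u ∈ M`
  -- would put a positive real multiple of `1` into `M`.
  let ε : ℝ := 1 / (2 * (n + 1))
  have hε : 0 < ε := by positivity
  have h2 : |a - s • (1 : A)| ≤
      ((a - (s + ε) • (1 : A)) ⊔ 0 + ((s - ε) • (1 : A) - a) ⊔ 0) + ε • (1 : A) := by
    refine abs_le'.2 ⟨?_, ?_⟩
    · have : a - s • (1 : A) = (a - (s + ε) • (1 : A)) + 0 + ε • (1 : A) := by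
        rw [add_smul]
        abel
      rw [this]
      exact add_le_add_left (add_le_add le_sup_left le_sup_right) _
    · have : -(a - s • (1 : A)) = 0 + ((s - ε) • (1 : A) - a) + ε • (1 : A) := by
        rw [sub_smul]
        abel
      rw [this]
      exact add_le_add_left (add_le_add le_sup_right le_sup_left) _
  set u := (a - (s + ε) • (1 : A)) ⊔ 0 + ((s - ε) • (1 : A) - a) ⊔ 0
  have hu : u ∈ M := M.add_mem (hup ε hε) (hlow ε hε)
  have h3 : (1 - n * ε) • (1 : A) ≤ m + n • u := by
    rw [sub_smul, one_smul, sub_le_iff_le_add, mul_smul, Nat.cast_smul_eq_nsmul, add_assoc,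
      ← smul_add]
    exact h1.trans (add_le_add_right (nsmul_le_nsmul_right h2 n) m)
  have h4 : 0 < 1 - n * ε := by
    have : (n : ℝ) * ε < 1 := by
      simp only [ε, mul_one_div]
      rw [div_lt_one (by positivity)]
      linarith [n.cast_nonneg (α := ℝ)]
    linarith
  exact smul_one_notMem hM h4.ne' (mem_of_nonneg_of_le hM (smul_nonneg h4.le zero_le_one) h3
    (M.add_mem hm (M.nsmul_mem hu n)))

/-- A maximal `ℓ`-ideal of a bounded algebra is the kernel of a point. -/
theorem exists_point_of_maximal (hA : IsBounded A) : ∃ p : Point A, ∀ a ∈ M, p a = 0 := by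
  have := hM.1.1
  choose f hf using exists_sub_smul_one_mem hM hA
  -- Uniqueness of the real representative reduces every homomorphism law for `f` to a membership in
  -- `M`.
  have huniq : ∀ {a : A} {r : ℝ}, a - r • (1 : A) ∈ M → f a = r := by
    intro a r h
    by_contra hne
    refine smul_one_notMem hM (sub_ne_zero.2 hne) ?_
    have := M.sub_mem h (hf a)
    rwa [sub_sub_sub_cancel_left, ← sub_smul] at this
  have hmul : ∀ a b : A, f (a * b) = f a * f b := fun a b => huniq (by
    have : a * b - (f a * f b) • (1 : A) =
        b * (a - f a • (1 : A)) + (f a • (1 : A)) * (b - f b • (1 : A)) := by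
      simp only [Algebra.smul_def, map_mul]
      ring
    rw [this]
    exact M.add_mem (M.mul_mem_left _ (hf a)) (M.mul_mem_left _ (hf b)))
  have hsmul_mono : ∀ {r s : ℝ}, r ≤ s → r • (1 : A) ≤ s • (1 : A) := fun h =>
    smul_le_smul_of_nonneg_right h zero_le_one
  let φ : A →ₐ[ℝ] ℝ := AlgHom.ofLinearMap
    { toFun := f
      map_add' := fun a b => huniq (by
        rw [add_smul, add_sub_add_comm]
        exact M.add_mem (hf a) (hf b))
      map_smul' := fun r a => huniq (by
        rw [RingHom.id_apply, smul_eq_mul, mul_smul, ← smul_sub]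
        exact Submodule.smul_of_tower_mem M r (hf a)) }
    (huniq (by simp)) hmul
  refine ⟨⟨φ, fun a b => huniq ?_, fun a b => huniq ?_⟩, fun a ha => huniq (by simpa using ha)⟩
  · have h := IsLIdeal.sup_sub_sup_mem M (hf a) (hf b)
    have : (f a ⊔ f b) • (1 : A) = f a • (1 : A) ⊔ f b • (1 : A) := by
      rcases le_total (f a) (f b) with h | h
      · rw [sup_eq_right.2 h, sup_eq_right.2 (hsmul_mono h)]
      · rw [sup_eq_left.2 h, sup_eq_left.2 (hsmul_mono h)]
    change a ⊔ b - (f a ⊔ f b) • (1 : A) ∈ M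
    rwa [this]
  · have h := IsLIdeal.inf_sub_inf_mem M (hf a) (hf b)
    have : (f a ⊓ f b) • (1 : A) = f a • (1 : A) ⊓ f b • (1 : A) := by
      rcases le_total (f a) (f b) with h | h
      · rw [inf_eq_left.2 h, inf_eq_left.2 (hsmul_mono h)]
      · rw [inf_eq_right.2 h, inf_eq_right.2 (hsmul_mono h)]
    change a ⊓ b - (f a ⊓ f b) • (1 : A) ∈ M
    rwa [this]

end maximal

/-! ### Points determine the order -/

theorem le_zero_of_forall_le_smul (hA' : IsArch A) {a : A}
    (h : ∀ ε : ℝ, 0 < ε → a ≤ ε • (1 : A)) : a ≤ 0 := by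
  refine hA' a 1 fun n => ?_
  have hn : (0 : ℝ) < n + 1 := by positivity
  calc n • a ≤ n • ((1 / ((n : ℝ) + 1)) • (1 : A)) :=
        nsmul_le_nsmul_right (h _ (by positivity)) n
    _ = ((n : ℝ) * (1 / ((n : ℝ) + 1))) • (1 : A) := by
        rw [← Nat.cast_smul_eq_nsmul ℝ, smul_smul]
    _ ≤ (1 : ℝ) • (1 : A) := by
        refine smul_le_smul_of_nonneg_right ?_ zero_le_one
        rw [mul_one_div, div_le_one hn]
        linarith
    _ = 1 := one_smul _ _

/-- The points of a bounded archimedean algebra determine its order. -/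
theorem le_of_forall_point (hA : IsBounded A) (hA' : IsArch A) {a b : A}
    (h : ∀ p : Point A, p a ≤ p b) : a ≤ b := by
  rw [← sub_nonpos]
  refine le_zero_of_forall_le_smul hA' fun ε hε => ?_
  by_contra hlt
  set d := a - b - ε • (1 : A) with hd
  -- If `1 ≤ n • d⁻`, then `d⁺` is below a multiple of `d⁻` while disjoint from it, so `d⁺ = 0` and
  -- `d ≤ 0`. Otherwise a point killing `d⁻` has `p d ≥ 0`; the margin `ε` in `d` turns this into
  -- the strict inequality `p b < p a`.
  have hd1 : 1 ∉ adjoin hA ⊥ d⁻ := by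
    rintro ⟨m, hm, -, n, h1⟩
    rw [(Submodule.mem_bot A).1 hm, zero_add, abs_of_nonneg zero_le_one] at h1
    obtain ⟨k, hk⟩ := hA d⁺
    have key : ∀ j : ℕ, d⁺ ⊓ (j • d⁻) ≤ 0 := by
      intro j
      induction j with
      | zero => simp
      | succ j ih =>
        have e1 : d⁺ ⊓ ((j + 1) • d⁻) ≤ d⁺ ⊓ (j • d⁻) + d⁺ ⊓ d⁻ := by
          rw [add_inf, inf_add, inf_add, succ_nsmul]
          refine le_inf (le_inf ?_ ?_) (le_inf ?_ inf_le_right)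
          · exact inf_le_left.trans (le_add_of_nonneg_right (posPart_nonneg d))
          · exact inf_le_left.trans
              (le_add_of_nonneg_left (nsmul_nonneg (negPart_nonneg d) j))
          · exact inf_le_left.trans (le_add_of_nonneg_right (negPart_nonneg d))
        refine e1.trans ?_
        rw [posPart_inf_negPart_eq_zero, add_zero]
        exact ih
    have h2 : d⁺ ≤ (k * n) • d⁻ := hk.trans (by
      rw [mul_smul]
      exact nsmul_le_nsmul_right h1 k)
    have h3 := key (k * n)
    rw [inf_eq_left.2 h2] at h3
    exact hlt (sub_nonpos.1 ((le_posPart d).trans h3))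
  have := adjoin_isLIdeal hA ⊥ d⁻
  obtain ⟨M, hJM, hM⟩ := exists_maximal_lIdeal _ hd1
  obtain ⟨p, hp⟩ := exists_point_of_maximal hM hA
  have h1 : p d⁻ = 0 := hp _ (hJM (mem_adjoin hA ⊥ d⁻ (negPart_nonneg d)))
  have h2 : 0 ≤ p d := by
    have := p.mono (neg_le_negPart d)
    rw [h1, map_neg] at this
    linarith
  rw [hd, map_sub, map_sub, map_smul, map_one, smul_eq_mul, mul_one] at h2
  linarith [h p]

theorem eq_of_forall_point (hA : IsBounded A) (hA' : IsArch A) {a b : A}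
    (h : ∀ p : Point A, p a = p b) : a = b :=
  le_antisymm (le_of_forall_point hA hA' fun p => (h p).le)
    (le_of_forall_point hA hA' fun p => (h p).ge)

end points

/-! ### Algebras of bounded functions -/

/-- The subalgebra of bounded functions. -/
def bddSubalgebra (Y : Type u) : Subalgebra ℝ (Y → ℝ) where
  carrier := {f | ∃ M : ℝ, ∀ y, |f y| ≤ M}
  mul_mem' := by
    rintro f g ⟨M, hM⟩ ⟨N, hN⟩
    refine ⟨M * N, fun y => ?_⟩
    rw [Pi.mul_apply, abs_mul]
    exact mul_le_mul (hM y) (hN y) (abs_nonneg _) ((abs_nonneg _).trans (hM y))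
  add_mem' := by
    rintro f g ⟨M, hM⟩ ⟨N, hN⟩
    exact ⟨M + N, fun y => (abs_add_le _ _).trans (add_le_add (hM y) (hN y))⟩
  algebraMap_mem' r := ⟨|r|, fun _ => le_rfl⟩

/-- The bounded real-valued functions on a set. -/
def Bdd (Y : Type u) : Type u := bddSubalgebra Y

namespace Bdd

variable {Y Z : Type u}

instance : CoeFun (Bdd Y) (fun _ => Y → ℝ) := ⟨fun f => f.1⟩

instance : CommRing (Bdd Y) := inferInstanceAs (CommRing (bddSubalgebra Y))

instance : Algebra ℝ (Bdd Y) := inferInstanceAs (Algebra ℝ (bddSubalgebra Y))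

instance : Lattice (Bdd Y) := Subtype.lattice (P := fun f : Y → ℝ => f ∈ bddSubalgebra Y)
  (by
    rintro f g ⟨M, hM⟩ ⟨N, hN⟩
    exact ⟨M ⊔ N, fun y => (abs_max_le_max_abs_abs).trans (max_le_max (hM y) (hN y))⟩)
  (by
    rintro f g ⟨M, hM⟩ ⟨N, hN⟩
    exact ⟨M ⊔ N, fun y => (abs_min_le_max_abs_abs).trans (max_le_max (hM y) (hN y))⟩)

@[ext]
theorem ext {f g : Bdd Y} (h : ∀ y, f y = g y) : f = g := Subtype.ext (funext h)

@[simp] theorem zero_apply (y : Y) : (0 : Bdd Y) y = 0 := rfl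
@[simp] theorem one_apply (y : Y) : (1 : Bdd Y) y = 1 := rfl
@[simp] theorem add_apply (f g : Bdd Y) (y : Y) : (f + g) y = f y + g y := rfl
@[simp] theorem neg_apply (f : Bdd Y) (y : Y) : (-f) y = -f y := rfl
@[simp] theorem mul_apply (f g : Bdd Y) (y : Y) : (f * g) y = f y * g y := rfl
@[simp] theorem smul_apply (r : ℝ) (f : Bdd Y) (y : Y) : (r • f) y = r * f y := rfl
@[simp] theorem nsmul_apply (n : ℕ) (f : Bdd Y) (y : Y) : (n • f) y = n * f y := by
  rw [← Nat.cast_smul_eq_nsmul ℝ, smul_apply]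
@[simp] theorem sup_apply (f g : Bdd Y) (y : Y) : (f ⊔ g) y = f y ⊔ g y := rfl
@[simp] theorem inf_apply (f g : Bdd Y) (y : Y) : (f ⊓ g) y = f y ⊓ g y := rfl

instance : IsOrderedAddMonoid (Bdd Y) where
  add_le_add_left _ _ h _ := fun y => add_le_add_left (h y) _

instance : LAlgebra (Bdd Y) :=
  letI : ZeroLEOneClass (Bdd Y) := ⟨fun _ => zero_le_one⟩
  letI : IsOrderedRing (Bdd Y) := .of_mul_nonneg fun _ _ hf hg y => mul_nonneg (hf y) (hg y)
  letI : IsOrderedModule ℝ (Bdd Y) := .of_smul_nonneg fun _ hr _ hf y => mul_nonneg hr (hf y)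
  { }

theorem isBounded : IsBounded (Bdd Y) := by
  rintro ⟨f, M, hM⟩
  obtain ⟨n, hn⟩ := exists_nat_ge M
  refine ⟨n, fun y => ((le_abs_self _).trans ((hM y).trans hn)).trans_eq ?_⟩
  exact ((nsmul_apply n 1 y).trans (mul_one _)).symm

theorem isArch : IsArch (Bdd Y) := by
  intro f g h y
  by_contra! hlt
  obtain ⟨n, hn⟩ := exists_nat_gt (g y / f y)
  have h1 := h n y
  rw [nsmul_apply] at h1
  exact absurd ((div_lt_iff₀ hlt).1 hn) (not_lt.2 h1)

open Classical in
/-- The function `f` with its value at `y` replaced by `r`. -/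
noncomputable def update (f : Bdd Y) (y : Y) (r : ℝ) : Bdd Y :=
  ⟨Function.update f y r, by
    obtain ⟨M, hM⟩ := f.2
    refine ⟨M ⊔ |r|, fun z => ?_⟩
    rcases eq_or_ne z y with rfl | h
    · simp
    · rw [Function.update_of_ne h]
      exact (hM z).trans le_sup_left⟩

@[simp] theorem update_self (f : Bdd Y) (y : Y) (r : ℝ) : f.update y r y = r := by
  simp [update]

theorem update_of_ne (f : Bdd Y) {y z : Y} (h : z ≠ y) (r : ℝ) : f.update y r z = f z := by
  simp [update, h]

/-- Changing `f` at the single point `y` to any bound of the values there leaves an upper bound of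
`S`, so leastness can be tested point by point. -/
theorem isLUB_apply {S : Set (Bdd Y)} {f : Bdd Y} (h : IsLUB S f) (y : Y) :
    IsLUB ((fun g : Bdd Y => g y) '' S) (f y) := by
  refine ⟨?_, fun r hr => ?_⟩
  · rintro _ ⟨g, hg, rfl⟩
    exact h.1 hg y
  · have : f ≤ f.update y r := h.2 fun g hg z => by
      rcases eq_or_ne z y with rfl | hz
      · exact (hr ⟨g, hg, rfl⟩).trans_eq (update_self f z r).symm
      · exact (h.1 hg z).trans_eq (update_of_ne f hz r).symm
    exact (this y).trans_eq (update_self f y r)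

theorem isGLB_apply {S : Set (Bdd Y)} {f : Bdd Y} (h : IsGLB S f) (y : Y) :
    IsGLB ((fun g : Bdd Y => g y) '' S) (f y) := by
  refine ⟨?_, fun r hr => ?_⟩
  · rintro _ ⟨g, hg, rfl⟩
    exact h.1 hg y
  · have : f.update y r ≤ f := h.2 fun g hg z => by
      rcases eq_or_ne z y with rfl | hz
      · exact (update_self f z r).trans_le (hr ⟨g, hg, rfl⟩)
      · exact (update_of_ne f hz r).trans_le (h.1 hg z)
    exact (update_self f y r).symm.trans_le (this y)

theorem isLUB_of_apply {S : Set (Bdd Y)} {f : Bdd Y}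
    (h : ∀ y, IsLUB ((fun g : Bdd Y => g y) '' S) (f y)) : IsLUB S f :=
  ⟨fun g hg y => (h y).1 ⟨g, hg, rfl⟩, fun g hg y => (h y).2 (by
    rintro _ ⟨k, hk, rfl⟩
    exact hg hk y)⟩

theorem isGLB_of_apply {S : Set (Bdd Y)} {f : Bdd Y}
    (h : ∀ y, IsGLB ((fun g : Bdd Y => g y) '' S) (f y)) : IsGLB S f :=
  ⟨fun g hg y => (h y).1 ⟨g, hg, rfl⟩, fun g hg y => (h y).2 (by
    rintro _ ⟨k, hk, rfl⟩
    exact hg hk y)⟩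

theorem isDedekindComplete : IsDedekindComplete (Bdd Y) := by
  rintro S ⟨f, hf⟩ ⟨b, hb⟩
  have hlub : ∀ y, IsLUB ((fun g : Bdd Y => g y) '' S) (sSup ((fun g : Bdd Y => g y) '' S)) :=
    fun y => isLUB_csSup ⟨_, f, hf, rfl⟩ ⟨b y, by
      rintro _ ⟨g, hg, rfl⟩
      exact hb hg y⟩
  obtain ⟨M, hM⟩ := f.2
  obtain ⟨N, hN⟩ := b.2
  refine ⟨⟨fun y => sSup ((fun g : Bdd Y => g y) '' S), M ⊔ N, fun y => abs_le.2 ⟨?_, ?_⟩⟩,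
    isLUB_of_apply hlub⟩
  · exact (neg_le_neg le_sup_left).trans ((abs_le.1 (hM y)).1.trans ((hlub y).1 ⟨f, hf, rfl⟩))
  · refine ((hlub y).2 ?_).trans ((abs_le.1 (hN y)).2.trans le_sup_right)
    rintro _ ⟨g, hg, rfl⟩
    exact hb hg y

theorem idempotent_apply {f : Bdd Y} (h : IsIdempotentElem f) (y : Y) : f y = 0 ∨ f y = 1 := by
  have h1 : f y * f y = f y := congrArg (fun g : Bdd Y => g y) h
  exact IsIdempotentElem.iff_eq_zero_or_one.1 h1

/-- Idempotents are `0`-`1` valued, and the indicator of a point where `f` equals `1` is an atom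
below `f`. -/
theorem isAtomic : IsAtomic (Idempotents (Bdd Y)) := by
  refine ⟨fun f => ?_⟩
  by_cases hf : ∀ y, f.1 y = 0
  · exact Or.inl (Subtype.ext (ext hf))
  push Not at hf
  obtain ⟨y, hy⟩ := hf
  have hy1 : f.1 y = 1 := (idempotent_apply f.2 y).resolve_left hy
  let d : Bdd Y := update 0 y 1
  have hd : IsIdempotentElem d := ext fun z => by
    rcases eq_or_ne z y with rfl | hz
    · simp [d]
    · simp [d, update_of_ne _ hz]
  refine Or.inr ⟨⟨d, hd⟩, ⟨fun h => ?_, fun g hg => ?_⟩, ?_⟩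
  · have := congrArg (fun g : Idempotents (Bdd Y) => g.1 y) h
    simp only [d, update_self] at this
    exact one_ne_zero this
  · have hle : g.1 * d = g.1 := congrArg Subtype.val (inf_eq_left.2 hg.le)
    have h0 : ∀ z, z ≠ y → g.1 z = 0 := fun z hz => by
      rw [← hle, mul_apply, update_of_ne _ hz, zero_apply, mul_zero]
    refine Subtype.ext (ext fun z => ?_)
    rcases eq_or_ne z y with rfl | hz
    · refine (idempotent_apply g.2 z).resolve_right fun h1 => hg.ne (Subtype.ext (ext fun x => ?_))
      rcases eq_or_ne x z with rfl | hx
      · rw [h1]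
        exact (update_self 0 x 1).symm
      · rw [h0 x hx]
        exact (update_of_ne 0 hx 1).symm
    · exact h0 z hz
  · refine inf_eq_left.1 (Subtype.ext (ext fun z => ?_))
    change d z * f.1 z = d z
    rcases eq_or_ne z y with rfl | hz
    · rw [hy1, mul_one]
    · simp [d, update_of_ne _ hz]

/-- The bounded archimedean algebra of bounded functions. -/
def bal (Y : Type u) : BAl.{u} := ⟨Bdd Y, isBounded, isArch⟩

/-- The basic algebra of bounded functions. -/
def basic (Y : Type u) : BAlg.{u} := ⟨bal Y, isDedekindComplete, isAtomic⟩

/-- Composition with a function. -/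
def pullback (h : Z → Y) : LHom (Bdd Y) (Bdd Z) where
  toAlgHom := AlgHom.ofLinearMap
    { toFun f := ⟨fun z => f (h z), by
        obtain ⟨M, hM⟩ := f.2
        exact ⟨M, fun z => hM (h z)⟩⟩
      map_add' _ _ := rfl
      map_smul' _ _ := rfl } rfl fun _ _ => rfl
  map_sup _ _ := rfl
  map_inf _ _ := rfl

end Bdd

/-- The homomorphism to bounded functions given by a family of points. -/
def evalHom {A Y : Type u} [LAlgebra A] (hA : IsBounded A) (p : Y → Point A) : LHom A (Bdd Y) where
  toAlgHom := AlgHom.ofLinearMap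
    { toFun a := ⟨fun y => p y a, by
        obtain ⟨n, hn⟩ := hA a
        obtain ⟨m, hm⟩ := hA (-a)
        refine ⟨n ⊔ m, fun y => abs_le'.2 ⟨?_, ?_⟩⟩
        · exact ((p y).mono hn).trans (by simp)
        · exact (map_neg (p y).toAlgHom a).symm.trans_le (((p y).mono hm).trans (by simp))⟩
      map_add' a b := Bdd.ext fun y => map_add (p y).toAlgHom a b
      map_smul' r a := Bdd.ext fun y => map_smul (p y).toAlgHom r a }
    (Bdd.ext fun y => map_one (p y).toAlgHom) fun a b => Bdd.ext fun y => map_mul (p y).toAlgHom a b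
  map_sup a b := Bdd.ext fun y => (p y).map_sup a b
  map_inf a b := Bdd.ext fun y => (p y).map_inf a b

/-! ### Basic algebras as algebras of bounded functions -/

section basic

variable {A : Type u} [LAlgebra A]

/-- Meets distribute over existing joins because `c ⊓ t = c + t - c ⊔ t` and translation preserves
order. -/
theorem inf_le_of_isLUB {T : Set A} {e c u : A} (h : IsLUB T e) (hc : ∀ t ∈ T, c ⊓ t ≤ u) :
    c ⊓ e ≤ u := by
  have h1 : e ≤ u + c ⊔ e - c := h.2 fun t ht => by
    rw [le_sub_iff_add_le, add_comm, ← inf_add_sup]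
    exact add_le_add (hc t ht) (sup_le_sup_left (h.1 ht) c)
  rw [le_sub_iff_add_le, add_comm, ← inf_add_sup] at h1
  exact le_of_add_le_add_right h1

theorem Point.apply_idempotent (p : Point A) {e : A} (he : IsIdempotentElem e) :
    p e = 0 ∨ p e = 1 :=
  IsIdempotentElem.iff_eq_zero_or_one.1 (he.map p.toAlgHom)

section
variable (hA : IsBounded A) (hA' : IsArch A)
include hA hA'

theorem nonneg_of_isIdempotentElem {e : A} (he : IsIdempotentElem e) : 0 ≤ e :=
  le_of_forall_point hA hA' fun p => by
    rw [map_zero]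
    rcases p.apply_idempotent he with h | h <;> rw [h]
    exact zero_le_one

variable (hD : IsDedekindComplete A)
include hD

/-- The support idempotent of a nonnegative element of a Dedekind complete algebra. -/
theorem exists_support {x : A} (hx : 0 ≤ x) : ∃ e : A, IsIdempotentElem e ∧ (∃ k : ℕ, x ≤ k • e) ∧
    ∀ c : A, 0 ≤ c → c ⊓ x ≤ 0 → c * e = 0 := by
  -- For functions, the join of the truncations `(n • x) ⊓ 1` is the indicator of the set where `x >
  -- 0`.
  obtain ⟨e, he⟩ := hD (Set.range fun n : ℕ => (n • x) ⊓ 1) ⟨_, 0, rfl⟩ ⟨1, by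
    rintro _ ⟨n, rfl⟩
    exact inf_le_right⟩
  have hle : ∀ n : ℕ, (n • x) ⊓ 1 ≤ e := fun n => he.1 ⟨n, rfl⟩
  have he0 : 0 ≤ e := by simpa using hle 0
  have he1 : e ≤ 1 := he.2 (by
    rintro _ ⟨n, rfl⟩
    exact inf_le_right)
  have h2 : IsLUB (Set.range fun n : ℕ => (2 : ℝ) • ((n • x) ⊓ 1)) ((2 : ℝ) • e) := by
    refine ⟨?_, fun u hu => ?_⟩
    · rintro _ ⟨n, rfl⟩
      exact smul_le_smul_of_nonneg_left (hle n) zero_le_two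
    · have h3 : e ≤ (1 / 2 : ℝ) • u := he.2 (by
        rintro _ ⟨n, rfl⟩
        have := smul_le_smul_of_nonneg_left (hu ⟨n, rfl⟩) (show (0 : ℝ) ≤ 1 / 2 by norm_num)
        rw [smul_smul] at this
        norm_num at this ⊢
        exact this)
      have := smul_le_smul_of_nonneg_left h3 (zero_le_two (α := ℝ))
      rw [smul_smul] at this
      norm_num at this
      exact this
  have hidem : 1 ⊓ (2 : ℝ) • e ≤ e := inf_le_of_isLUB h2 (by
    rintro _ ⟨n, rfl⟩
    refine le_trans (le_inf ?_ inf_le_left) (hle (2 * n))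
    refine inf_le_right.trans ?_
    rw [mul_smul, ← Nat.cast_smul_eq_nsmul ℝ 2, Nat.cast_ofNat]
    exact smul_le_smul_of_nonneg_left inf_le_left zero_le_two)
  -- A point need not preserve the join defining `e`. The finite relations `0 ≤ e ≤ 1` and `1 ⊓ 2e ≤
  -- e` are preserved, and they leave only the values `0` and `1`.
  have hp : ∀ p : Point A, p e = 0 ∨ p e = 1 := by
    intro p
    have h3 := p.mono hidem
    have h4 := p.mono he0
    have h5 := p.mono he1
    rw [p.map_inf, map_one, map_smul, smul_eq_mul] at h3
    rw [map_zero] at h4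
    rw [map_one] at h5
    rcases inf_le_iff.1 h3 with h | h
    · exact Or.inr (le_antisymm h5 h)
    · exact Or.inl (by linarith)
  refine ⟨e, eq_of_forall_point hA hA' fun p => ?_, ?_, fun c hc hcx => ?_⟩
  · rw [map_mul]
    rcases hp p with h | h <;> simp [h]
  · obtain ⟨k, hk⟩ := hA x
    refine ⟨k + 1, le_of_forall_point hA hA' fun p => ?_⟩
    have h3 := p.mono hk
    have h4 := p.mono (hle 1)
    have h5 := p.mono hx
    simp only [map_nsmul, map_one, p.map_inf, map_zero, one_smul] at h3 h4 h5 ⊢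
    simp only [nsmul_eq_mul] at h3 ⊢
    rcases hp p with h | h <;> rw [h] at h4 ⊢ <;> push_cast
    · have : p x ≤ 0 := (inf_le_iff.1 h4).resolve_right (by norm_num)
      linarith
    · linarith
  · have h3 : c ⊓ e ≤ 0 := inf_le_of_isLUB he (by
      rintro _ ⟨n, rfl⟩
      refine le_of_forall_point hA hA' fun p => ?_
      have h4 := p.mono hcx
      have h5 := p.mono hx
      simp only [map_nsmul, map_one, p.map_inf, map_zero] at h4 h5 ⊢
      rw [nsmul_eq_mul]
      rcases inf_le_iff.1 h4 with h | h
      · exact inf_le_of_left_le h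
      · refine inf_le_of_right_le (inf_le_of_left_le ?_)
        exact mul_nonpos_of_nonneg_of_nonpos n.cast_nonneg h)
    refine eq_of_forall_point hA hA' fun p => ?_
    have h4 := p.mono h3
    have h5 := p.mono hc
    simp only [map_mul, p.map_inf, map_zero] at h4 h5 ⊢
    rcases hp p with h | h <;> rw [h] at h4 ⊢
    · simp
    · rw [mul_one]
      exact le_antisymm ((inf_le_iff.1 h4).resolve_right (by norm_num)) h5

/-- An atom lies below the support of `x⁺` or is disjoint from it; it then annihilates `x⁻` or `x⁺`
respectively. -/
theorem atom_mul_le_or_ge {z : Idempotents A} (hz : IsAtom z) (x : A) :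
    x * z.1 ≤ 0 ∨ 0 ≤ x * z.1 := by
  have hz0 := nonneg_of_isIdempotentElem hA hA' z.2
  obtain ⟨e, he, ⟨k, hk⟩, h⟩ := exists_support hA hA' hD (posPart_nonneg x)
  have hm : x⁻ * e = 0 := h _ (negPart_nonneg x) (by
    rw [inf_comm, posPart_inf_negPart_eq_zero])
  have hx : x = x⁺ - x⁻ := (posPart_sub_negPart x).symm
  rcases hz.le_iff.1 (inf_le_left (a := z) (b := ⟨e, he⟩)) with h1 | h1
  · have h2 : z.1 * e = 0 := congrArg Subtype.val h1
    left
    have h3 : x⁺ * z.1 ≤ 0 := by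
      refine (mul_le_mul_of_nonneg_right hk hz0).trans_eq ?_
      rw [smul_mul_assoc, mul_comm, h2, smul_zero]
    rw [hx, sub_mul, sub_nonpos]
    exact h3.trans (mul_nonneg (negPart_nonneg x) hz0)
  · have h2 : z.1 * e = z.1 := congrArg Subtype.val h1
    right
    have h3 : x⁻ * z.1 = 0 := by
      rw [← h2, mul_comm z.1, ← mul_assoc, hm, zero_mul]
    rw [hx, sub_mul, h3, sub_zero]
    exact mul_nonneg (posPart_nonneg x) hz0

/-- Since `a * z` is comparable with every `r • z`, it determines a cut in `ℝ`; the archimedean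
property gives equality at the cut. -/
theorem exists_mul_atom_eq_smul {z : Idempotents A} (hz : IsAtom z) (a : A) :
    ∃ r : ℝ, a * z.1 = r • z.1 := by
  have hz0 := nonneg_of_isIdempotentElem hA hA' z.2
  have hzne : z.1 ≠ 0 := fun h => hz.1 (Subtype.ext h)
  have hz1 : z.1 ≤ 1 := le_of_forall_point hA hA' fun p => by
    rw [map_one]
    rcases p.apply_idempotent z.2 with h | h <;> rw [h]
    exact zero_le_one
  let S : Set ℝ := {r | a * z.1 ≤ r • z.1}
  have hdich : ∀ r : ℝ, a * z.1 ≤ r • z.1 ∨ r • z.1 ≤ a * z.1 := fun r => by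
    have := atom_mul_le_or_ge hA hA' hD hz (a - r • (1 : A))
    rwa [sub_mul, smul_mul_assoc, one_mul, sub_nonpos, sub_nonneg] at this
  have hne : S.Nonempty := by
    obtain ⟨n, hn⟩ := hA a
    refine ⟨n, (mul_le_mul_of_nonneg_right hn hz0).trans_eq ?_⟩
    rw [smul_mul_assoc, one_mul, Nat.cast_smul_eq_nsmul]
  have hbdd : BddBelow S := by
    obtain ⟨n, hn⟩ := hA (-a)
    refine ⟨-n, fun r (hr : _ ≤ _) => ?_⟩
    by_contra! h
    have h1 := mul_le_mul_of_nonneg_right hn hz0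
    rw [smul_mul_assoc, one_mul, neg_mul, ← Nat.cast_smul_eq_nsmul ℝ, neg_le] at h1
    have h2 : (-(n : ℝ) - r) • z.1 ≤ 0 := by
      rw [sub_smul, neg_smul, sub_nonpos]
      exact h1.trans hr
    have h3 := smul_le_smul_of_nonneg_left h2 (show 0 ≤ (-(n : ℝ) - r)⁻¹ by
      rw [inv_nonneg]
      linarith)
    rw [smul_smul, inv_mul_cancel₀ (by linarith), one_smul, smul_zero] at h3
    exact hzne (le_antisymm h3 hz0)
  refine ⟨sInf S, le_antisymm ?_ ?_⟩
  · rw [← sub_nonpos]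
    refine le_zero_of_forall_le_smul hA' fun ε hε => ?_
    obtain ⟨r, hr, hr'⟩ := exists_lt_of_csInf_lt hne (show sInf S < sInf S + ε by linarith)
    have h1 : a * z.1 ≤ (sInf S + ε) • z.1 :=
      le_trans hr (smul_le_smul_of_nonneg_right hr'.le hz0)
    rw [add_smul] at h1
    exact (sub_le_iff_le_add'.2 h1).trans (smul_le_smul_of_nonneg_left hz1 hε.le)
  · rw [← sub_nonpos]
    refine le_zero_of_forall_le_smul hA' fun ε hε => ?_
    have h1 : (sInf S - ε) • z.1 ≤ a * z.1 := (hdich _).resolve_left fun h => by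
      have := csInf_le hbdd h
      linarith
    rw [sub_smul, sub_le_comm] at h1
    exact h1.trans (smul_le_smul_of_nonneg_left hz1 hε.le)

/-- An atom of the algebra of idempotents of a Dedekind complete algebra determines a point. -/
theorem exists_point_of_atom {z : Idempotents A} (hz : IsAtom z) :
    ∃ p : Point A, p z.1 = 1 ∧ ∀ a : A, a * z.1 = p a • z.1 := by
  have hzne : z.1 ≠ 0 := fun h => hz.1 (Subtype.ext h)
  -- Any point not vanishing on `z` works: applying it to `a * z = r • z` identifies `r` as `p a`.
  obtain ⟨p, hp⟩ : ∃ p : Point A, p z.1 ≠ 0 := by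
    by_contra! h
    exact hzne (eq_of_forall_point hA hA' fun p => (h p).trans (map_zero p.toAlgHom).symm)
  have hp1 : p z.1 = 1 := (p.apply_idempotent z.2).resolve_left hp
  refine ⟨p, hp1, fun a => ?_⟩
  obtain ⟨r, hr⟩ := exists_mul_atom_eq_smul hA hA' hD hz a
  have h1 := congrArg p.toAlgHom hr
  rw [map_mul, map_smul, hp1, mul_one, smul_eq_mul, mul_one] at h1
  rw [hr, h1]

end

end basic

/-! ### Values at atoms -/

namespace BAlg

variable (C : BAlg.{u})

/-- The atoms of the algebra of idempotents. -/
abbrev Atoms : Type u := {z : Idempotents C.toBAl // IsAtom z}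

/-- The point determined by an atom. -/
noncomputable def atomPoint (z : C.Atoms) : Point C.toBAl :=
  (exists_point_of_atom C.toBAl.bounded C.toBAl.arch C.complete z.2).choose

variable {C}

theorem atomPoint_self (z : C.Atoms) : C.atomPoint z z.1.1 = 1 :=
  (exists_point_of_atom C.toBAl.bounded C.toBAl.arch C.complete z.2).choose_spec.1

theorem mul_atom (z : C.Atoms) (a : C.toBAl) : a * z.1.1 = C.atomPoint z a • z.1.1 :=
  (exists_point_of_atom C.toBAl.bounded C.toBAl.arch C.complete z.2).choose_spec.2 a

theorem atomPoint_of_ne {z z' : C.Atoms} (h : z ≠ z') : C.atomPoint z z'.1.1 = 0 := by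
  have h1 : z'.1 ⊓ z.1 = ⊥ := by
    rcases z.2.le_iff.1 (inf_le_right (a := z'.1) (b := z.1)) with h1 | h1
    · exact h1
    · rcases z'.2.le_iff.1 (inf_le_left (a := z'.1) (b := z.1)) with h2 | h2
      · exact h2
      · exact absurd (Subtype.ext (h1.symm.trans h2)) h
  have h2 : z'.1.1 * z.1.1 = 0 := congrArg Subtype.val h1
  have h3 := congrArg (C.atomPoint z).toAlgHom h2
  rwa [map_mul, map_zero, atomPoint_self, mul_one] at h3

/-- Atomicity enters here. An atom below the support of `(a - b)⁺` would be disjoint from `(a -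
b)⁺`, whose value at that atom is `0`, hence disjoint from the support itself. -/
theorem le_of_forall_atomPoint {a b : C.toBAl} (h : ∀ z, C.atomPoint z a ≤ C.atomPoint z b) :
    a ≤ b := by
  obtain ⟨e, he, ⟨k, hk⟩, hc⟩ := exists_support C.toBAl.bounded C.toBAl.arch C.complete
    (posPart_nonneg (a - b))
  suffices e = 0 by
    rw [this, smul_zero] at hk
    exact sub_nonpos.1 ((le_posPart _).trans hk)
  have := C.atomic
  rcases this.eq_bot_or_exists_atom_le ⟨e, he⟩ with h1 | ⟨z, hz, hze⟩
  · exact congrArg Subtype.val h1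
  · have hp : C.atomPoint ⟨z, hz⟩ (a - b)⁺ = 0 := by
      rw [posPart_def, Point.map_sup, map_sub, map_zero, sup_eq_right]
      linarith [h ⟨z, hz⟩]
    have h2 : z.1 * e = z.1 := congrArg Subtype.val (inf_eq_left.2 hze)
    refine absurd ((?_ : z.1 = 0)) fun h0 => hz.1 (Subtype.ext h0)
    rw [← h2]
    refine hc _ (nonneg_of_isIdempotentElem C.toBAl.bounded C.toBAl.arch z.2) ?_
    refine le_of_forall_point C.toBAl.bounded C.toBAl.arch fun p => ?_
    have h3 := congrArg p.toAlgHom (mul_atom ⟨z, hz⟩ (a - b)⁺)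
    rw [hp, zero_smul, map_mul, map_zero] at h3
    rw [Point.map_inf, map_zero]
    rcases mul_eq_zero.1 h3 with h4 | h4
    · exact inf_le_of_right_le h4.le
    · exact inf_le_of_left_le h4.le

theorem eq_of_forall_atomPoint {a b : C.toBAl} (h : ∀ z, C.atomPoint z a = C.atomPoint z b) :
    a = b :=
  le_antisymm (le_of_forall_atomPoint fun z => (h z).le)
    (le_of_forall_atomPoint fun z => (h z).ge)

-- The element is a join of multiples of the atoms, after a shift by `K` that makes all coefficients
-- nonnegative.
open Classical in
theorem exists_atomPoint_eq (f : Bdd C.Atoms) : ∃ a : C.toBAl, ∀ z, C.atomPoint z a = f z := by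
  obtain ⟨M, hM⟩ := f.2
  let K := M ⊔ 0
  have hK : 0 ≤ K := le_sup_right
  have hfK : ∀ z, 0 ≤ f z + K ∧ f z + K ≤ 2 * K := fun z => by
    have := abs_le.1 ((hM z).trans (le_sup_left : M ≤ K))
    constructor <;> linarith
  -- This bound takes the value `f z + K` at `z` and `2 * K` at the other atoms, so it limits the
  -- join from above exactly at `z` without assuming that `atomPoint` preserves joins.
  have hub : ∀ z : C.Atoms, (f z + K) • z.1.1 + (2 * K) • (1 - z.1.1) ∈
      upperBounds (insert 0 (Set.range fun z : C.Atoms => (f z + K) • z.1.1)) := by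
    intro z
    refine fun u hu => le_of_forall_atomPoint fun y => ?_
    have hy : C.atomPoint y ((f z + K) • z.1.1 + (2 * K) • (1 - z.1.1)) =
        if y = z then f y + K else 2 * K := by
      simp only [map_add, map_smul, map_sub, map_one, smul_eq_mul]
      split_ifs with h
      · subst h
        simp [atomPoint_self]
      · simp [atomPoint_of_ne h]
    rw [hy]
    rcases hu with rfl | ⟨x, rfl⟩
    · rw [map_zero]
      split_ifs
      · exact (hfK y).1
      · linarith
    · rw [map_smul, smul_eq_mul]
      by_cases hx : y = x
      · subst hx
        rw [atomPoint_self, mul_one]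
        split_ifs
        · exact le_rfl
        · exact (hfK y).2
      · rw [atomPoint_of_ne hx, mul_zero]
        split_ifs
        · exact (hfK y).1
        · linarith
  -- Inserting `0` keeps the set nonempty when there are no atoms.
  obtain ⟨a, ha⟩ := C.complete (insert 0 (Set.range fun z : C.Atoms => (f z + K) • z.1.1))
    (Set.insert_nonempty _ _) ⟨(2 * K) • 1, fun u hu => le_of_forall_atomPoint fun y => by
      rw [map_smul, map_one, smul_eq_mul, mul_one]
      refine ((C.atomPoint y).mono (hub y hu)).trans ?_
      simp only [map_add, map_smul, map_sub, map_one, atomPoint_self, smul_eq_mul]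
      linarith [(hfK y).2]⟩
  refine ⟨a - K • 1, fun z => ?_⟩
  have h1 := (C.atomPoint z).mono (ha.1 (Set.mem_insert_of_mem _ ⟨z, rfl⟩))
  have h2 := (C.atomPoint z).mono (ha.2 (hub z))
  simp only [map_add, map_smul, map_sub, map_one, atomPoint_self, smul_eq_mul] at h1 h2 ⊢
  linarith

/-- The element of a basic algebra with prescribed values at the atoms. -/
noncomputable def ofAtoms (f : Bdd C.Atoms) : C.toBAl := (exists_atomPoint_eq f).choose

@[simp] theorem atomPoint_ofAtoms (z : C.Atoms) (f : Bdd C.Atoms) :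
    C.atomPoint z (ofAtoms f) = f z := (exists_atomPoint_eq f).choose_spec z

variable (C) in
/-- A basic algebra is the algebra of bounded functions on its atoms. -/
noncomputable def ofAtomsHom : LHom (Bdd C.Atoms) C.toBAl where
  toAlgHom := AlgHom.ofLinearMap
    { toFun := ofAtoms
      map_add' _ _ := eq_of_forall_atomPoint fun z => by simp
      map_smul' _ _ := eq_of_forall_atomPoint fun z => by simp }
    (eq_of_forall_atomPoint fun z => by simp) fun _ _ => eq_of_forall_atomPoint fun z => by simp
  map_sup f g := eq_of_forall_atomPoint fun z => by
    rw [Point.map_sup]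
    change C.atomPoint z (ofAtoms _) = C.atomPoint z (ofAtoms _) ⊔ C.atomPoint z (ofAtoms _)
    simp
  map_inf f g := eq_of_forall_atomPoint fun z => by
    rw [Point.map_inf]
    change C.atomPoint z (ofAtoms _) = C.atomPoint z (ofAtoms _) ⊓ C.atomPoint z (ofAtoms _)
    simp

/-- The normal homomorphism induced by a function from the atoms. -/
noncomputable def ofAtomMap {Y : Type u} (h : C.Atoms → Y) : Bdd.basic Y ⟶ C :=
  ⟨LHom.comp C.ofAtomsHom (Bdd.pullback h), by
    -- Normality follows because joins and meets of bounded functions are pointwise and the order of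
    -- `C` is tested at atoms.
    have hv : ∀ (f : Bdd Y) z, C.atomPoint z (LHom.comp C.ofAtomsHom (Bdd.pullback h) f) = f (h z) :=
      fun f z => atomPoint_ofAtoms z _
    refine ⟨fun S f hf => ⟨?_, fun c hc => le_of_forall_atomPoint fun z => ?_⟩,
      fun S f hf => ⟨?_, fun c hc => le_of_forall_atomPoint fun z => ?_⟩⟩
    · rintro _ ⟨g, hg, rfl⟩
      exact LHom.mono _ (hf.1 hg)
    · refine (hv f z).trans_le ((Bdd.isLUB_apply hf (h z)).2 ?_)
      rintro _ ⟨g, hg, rfl⟩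
      exact (hv g z).symm.trans_le ((C.atomPoint z).mono (hc ⟨g, hg, rfl⟩))
    · rintro _ ⟨g, hg, rfl⟩
      exact LHom.mono _ (hf.1 hg)
    · refine ((Bdd.isGLB_apply hf (h z)).2 ?_).trans_eq (hv f z).symm
      rintro _ ⟨g, hg, rfl⟩
      exact ((C.atomPoint z).mono (hc ⟨g, hg, rfl⟩)).trans_eq (hv g z)⟩

theorem atomPoint_ofAtomMap {Y : Type u} (h : C.Atoms → Y) (f : Bdd Y) (z : C.Atoms) :
    C.atomPoint z ((ofAtomMap h).1 f) = f (h z) := atomPoint_ofAtoms z _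

end BAlg

/-! ### The canonical extension of the free algebra on a weighted set -/

/-- The real-valued functions on a weighted set that are bounded by the weight. -/
def Box (W : WSet.{u}) : Type u := {y : W.carrier → ℝ // ∀ x, |y x| ≤ W.w x}

instance (W : WSet.{u}) : TopologicalSpace (Box W) :=
  inferInstanceAs (TopologicalSpace {y : W.carrier → ℝ // ∀ x, |y x| ≤ W.w x})

instance (W : WSet.{u}) : CompactSpace (Box W) := by
  suffices IsCompact {y : W.carrier → ℝ | ∀ x, |y x| ≤ W.w x} from
    isCompact_iff_compactSpace.1 this
  have h := isCompact_univ_pi fun x : W.carrier => isCompact_Icc (a := -W.w x) (b := W.w x)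
  convert h using 1
  ext y
  simp only [Set.mem_ofPred_eq, Set.mem_univ_pi, Set.mem_Icc, abs_le]

namespace Box

variable {W : WSet.{u}}

/-- The point of the box given by a point of an algebra under the weighted set. -/
noncomputable def ofPoint {A : BAl.{u}} (h : W ⟶ BAl.toWSet.obj A) (p : Point A) : Box W :=
  ⟨fun x => p (h.1 x), fun x => by
    have h1 : |(show A from h.1 x)| ≤ W.w x • (1 : A) :=
      (abs_le_lnorm A.bounded A.arch _).trans
        (smul_le_smul_of_nonneg_right (h.2 x) zero_le_one)
    have h2 := p.mono ((le_abs_self _).trans h1)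
    have h3 := p.mono ((neg_le_abs _).trans h1)
    rw [map_smul, map_one, smul_eq_mul, mul_one] at h2 h3
    rw [map_neg] at h3
    exact abs_le'.2 ⟨h2, h3⟩⟩

variable (W)

/-- The coordinate functions on the box. -/
noncomputable def coord : W ⟶ BAl.toWSet.obj (Bdd.bal (Box W)) :=
  ⟨fun x => (⟨fun y => y.1 x, W.w x, fun y => y.2 x⟩ : Bdd (Box W)), fun x =>
    lnorm_le (A := Bdd (Box W)) (W.w_nonneg x) fun y => (y.2 x).trans_eq (mul_one _).symm⟩

/-- The representation of the free algebra by functions on the box. -/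
noncomputable def rep : LHom (freeObj W) (Bdd (Box W)) := freeLift (coord W)

/-- Each point of the free algebra is `rep` followed by evaluation at its values on the generators,
and points separate elements. -/
theorem rep_injective : Function.Injective (rep W) := by
  have h : LHom.comp (Bdd.pullback (ofPoint (freeUnit W))) (rep W) =
      evalHom (freeObj W).bounded (fun p : Point (freeObj W) => p) :=
    free_hom_ext (A := Bdd.bal (Point (freeObj W))) rfl
  intro a b hab
  refine eq_of_forall_point (freeObj W).bounded (freeObj W).arch fun p => ?_
  have h1 : ∀ a, p a = rep W a (ofPoint (freeUnit W) p) := fun a =>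
    (congrArg (fun k : LHom (freeObj W) (Bdd (Point (freeObj W))) => k a p) h).symm
  rw [h1, h1, hab]

theorem continuous_rep (a : freeObj W) : Continuous (rep W a) := by
  obtain ⟨⟨t⟩, rfl⟩ := Ideal.Quotient.mk_surjective a
  change Continuous (Term.eval (A := Bdd (Box W)) (coord W).1 t)
  induction t with
  | var x => exact (continuous_apply x).comp continuous_subtype_val
  | zero => exact continuous_const
  | one => exact continuous_const
  | add s t hs ht => exact hs.add ht
  | neg s hs => exact hs.neg
  | mul s t hs ht => exact hs.mul ht
  | smul r s hs => exact continuous_const.mul hs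
  | sup s t hs ht => exact hs.sup ht
  | inf s t hs ht => exact hs.inf ht

theorem isCanonicalExtension_rep :
    IsCanonicalExtension (A := freeObj W) (C := Bdd.basic (Box W)) (rep W) where
  injective := rep_injective W
  dense f := by
    change Bdd (Box W) at f
    obtain ⟨M, hM⟩ := f.2
    have hf : ∀ y, -M ≤ f y := fun y => (abs_le.1 (hM y)).1
    let d : Box W → Bdd (Box W) := fun y => Bdd.update ((-M) • 1) y (f y)
    have hd : ∀ {y z}, z ≠ y → d y z = -M := fun {y z} h => by
      simp [d, Bdd.update_of_ne _ h]
    have hds : ∀ y, d y y = f y := fun y => Bdd.update_self _ _ _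
    refine ⟨Set.range d, ?_, Bdd.isLUB_of_apply fun z => ⟨?_, fun r hr => ?_⟩⟩
    · rintro _ ⟨y, rfl⟩
      let g : W.carrier → freeObj W := FreeCarrier.of W
      let k : ℕ → W.carrier → freeObj W := fun n x =>
        -- A tent of height `f y` and slope `n` in the coordinate `x`, cut off below at `-M`. The
        -- meet over all `n` and `x` is `f y` at `y` and `-M` elsewhere.
        ((-M) • 1) ⊔ (f y • 1 - (n : ℝ) • |g x - y.1 x • 1|)
      have hk : ∀ n x z, rep W (k n x) z = (-M) ⊔ (f y - n * |z.1 x - y.1 x|) := by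
        intro n x z
        have h : rep W (k n x) = ((-M) • 1) ⊔
            (f y • 1 - (n : ℝ) • |rep W (g x) - y.1 x • 1|) := by
          simp only [k, LHom.map_sup, LHom.map_abs, map_sub, map_smul, map_one]
        rw [h]
        change ((-M) * 1) ⊔ (f y * 1 - (n : ℝ) * |z.1 x - y.1 x * 1|) = _
        simp only [mul_one]
      have h1 : ∀ z, rep W (f y • (1 : freeObj W)) z = f y := fun z => by
        rw [map_smul, map_one, Bdd.smul_apply, Bdd.one_apply, mul_one]
      -- The constant `f y` is needed when there are no generators: the box is then one point and
      -- there are no tents.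
      refine ⟨insert (f y • 1) {a | ∃ n x, a = k n x}, Bdd.isGLB_of_apply fun z => ⟨?_, ?_⟩⟩
      · have hz : d y z ≤ f y := by
          rcases eq_or_ne z y with rfl | h
          · exact (hds z).le
          · exact (hd h).trans_le (hf y)
        rintro _ ⟨_, ⟨a, rfl | ⟨n, x, rfl⟩, rfl⟩, rfl⟩
        · exact hz.trans_eq (h1 z).symm
        · refine le_trans ?_ (hk n x z).ge
          rcases eq_or_ne z y with rfl | h
          · rw [sub_self, abs_zero, mul_zero, sub_zero]
            exact hz.trans le_sup_right
          · exact (hd h).trans_le le_sup_left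
      · intro r hr
        rcases eq_or_ne z y with rfl | h
        · exact (hr ⟨_, ⟨_, Set.mem_insert _ _, rfl⟩, rfl⟩).trans_eq ((h1 z).trans (hds z).symm)
        · obtain ⟨x, hx⟩ : ∃ x, z.1 x ≠ y.1 x := by
            by_contra! h'
            exact h (Subtype.ext (funext h'))
          have hpos : 0 < |z.1 x - y.1 x| := abs_pos.2 (sub_ne_zero.2 hx)
          obtain ⟨n, hn⟩ := exists_nat_ge ((f y + M) / |z.1 x - y.1 x|)
          rw [div_le_iff₀ hpos] at hn
          refine (hr ⟨_, ⟨_, Set.mem_insert_of_mem _ ⟨n, x, rfl⟩, rfl⟩, rfl⟩).trans ?_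
          refine (hk n x z).trans_le ?_
          rw [hd h]
          exact sup_le le_rfl (by linarith)
    · rintro _ ⟨_, ⟨y, rfl⟩, rfl⟩
      rcases eq_or_ne z y with rfl | h
      · exact (hds z).le
      · exact (hd h).trans_le (hf z)
    · exact (hds z).symm.trans_le (hr ⟨_, ⟨z, rfl⟩, rfl⟩)
  compact S T hS hT ε hε s t hs ht hst := by
    classical
    obtain ⟨a₀, ha₀⟩ := hS
    obtain ⟨b₀, hb₀⟩ := hT
    -- The gap `ε` gives, at each `z`, some `a ∈ S` below and some `b ∈ T` above the level `s z + ε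
    -- / 2`. The resulting strict inequalities define open sets.
    have hcover : (Set.univ : Set (Box W)) ⊆
        ⋃ i : S × T, {z | rep W i.1 z < rep W i.2 z} := by
      intro z _
      have h1 := Bdd.isGLB_apply hs z
      have h2 := Bdd.isLUB_apply ht z
      have h3 : s.1 z + ε * 1 ≤ t.1 z := hst z
      obtain ⟨_, ⟨_, ⟨a, ha, rfl⟩, rfl⟩, hlt⟩ :=
        (isGLB_lt_iff h1).1 (show s.1 z < s.1 z + ε / 2 by linarith)
      obtain ⟨_, ⟨_, ⟨b, hb, rfl⟩, rfl⟩, hlt'⟩ :=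
        (lt_isLUB_iff h2).1 (show s.1 z + ε / 2 < t.1 z by linarith)
      exact Set.mem_iUnion.2 ⟨(⟨a, ha⟩, ⟨b, hb⟩), hlt.trans hlt'⟩
    obtain ⟨F, hF⟩ := isCompact_univ.elim_finite_subcover _
      (fun i : S × T => isOpen_lt (continuous_rep W i.1) (continuous_rep W i.2)) hcover
    refine ⟨insert a₀ (F.image fun i => i.1.1), insert b₀ (F.image fun i => i.2.1),
      Finset.insert_nonempty _ _, Finset.insert_nonempty _ _, ?_, ?_, fun z => ?_⟩
    · intro a ha
      rw [Finset.mem_coe, Finset.mem_insert, Finset.mem_image] at ha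
      rcases ha with rfl | ⟨i, -, rfl⟩
      · exact ha₀
      · exact i.1.2
    · intro a ha
      rw [Finset.mem_coe, Finset.mem_insert, Finset.mem_image] at ha
      rcases ha with rfl | ⟨i, -, rfl⟩
      · exact hb₀
      · exact i.2.2
    · obtain ⟨i, hi, hz⟩ := Set.mem_iUnion₂.1 (hF (Set.mem_univ z))
      have h1 := Finset.inf'_le (rep W)
        (Finset.mem_insert_of_mem (b := a₀) (Finset.mem_image_of_mem (fun i => i.1.1) hi)) z
      have h2 := Finset.le_sup' (rep W)
        (Finset.mem_insert_of_mem (b := b₀) (Finset.mem_image_of_mem (fun i => i.2.1) hi)) z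
      exact h1.trans ((le_of_lt hz).trans h2)

end Box

/-- Normal homomorphisms from a canonical extension are determined on the original algebra. -/
theorem IsCanonicalExtension.hom_ext {A : BAl.{u}} {C D : BAlg.{u}} {e : LHom A C.toBAl}
    (he : IsCanonicalExtension e) {p q : C ⟶ D}
    (h : LHom.comp p.1 e = LHom.comp q.1 e) : p = q := by
  have h0 : ∀ a, p.1 (e a) = q.1 (e a) := fun a =>
    congrArg (fun k : LHom A D.toBAl => k a) h
  refine Subtype.ext (LHom.ext (AlgHom.ext fun x => ?_))
  obtain ⟨M, hM, hx⟩ := he.dense x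
  -- Agreement spreads from the image of `e` to its meets, then to joins of those, by normality and
  -- uniqueness of bounds.
  have h1 : ∀ m ∈ M, p.1 m = q.1 m := by
    intro m hm
    obtain ⟨S, hS⟩ := hM m hm
    have hp := p.2.map_isGLB _ _ hS
    have hq := q.2.map_isGLB _ _ hS
    rw [Set.image_image] at hp hq
    rw [Set.image_congr fun a _ => h0 a] at hp
    exact hp.unique hq
  have hp := p.2.map_isLUB _ _ hx
  rw [Set.image_congr h1] at hp
  exact hp.unique (q.2.map_isLUB _ _ hx)

/-! ### The adjunction -/

namespace Box

/-- The canonical map of a weighted set to the basic algebra of bounded functions on its box. -/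
noncomputable def unit (W : WSet.{u}) : W ⟶ BAlg.toWSet.obj (Bdd.basic (Box W)) :=
  freeUnit W ≫ BAl.toWSet.map (Y := Bdd.bal (Box W)) (rep W)

/-- Normal homomorphisms from the algebra of bounded functions on the box of a weighted set
correspond to morphisms of weighted sets. -/
noncomputable def homEquiv (W : WSet.{u}) (C : BAlg.{u}) :
    (Bdd.basic (Box W) ⟶ C) ≃ (W ⟶ BAlg.toWSet.obj C) where
  toFun g := unit W ≫ BAlg.toWSet.map g
  -- Each atom `z` gives the point of the box with coordinates `C.atomPoint z (h x)`; the
  -- homomorphism pulls functions back along this map.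
  invFun h := BAlg.ofAtomMap fun z => ofPoint (A := C.toBAl) h (C.atomPoint z)
  left_inv g := by
    refine (isCanonicalExtension_rep W).hom_ext
      (free_hom_ext (A := C.toBAl) (Subtype.ext (funext fun x => ?_)))
    exact BAlg.eq_of_forall_atomPoint fun z => BAlg.atomPoint_ofAtomMap _ _ z
  right_inv h := Subtype.ext (funext fun x =>
    BAlg.eq_of_forall_atomPoint fun z => BAlg.atomPoint_ofAtomMap _ _ z)

end Box

end WeightedFree

theorem proposition4p4 :
    ∃ (L : WeightedFree.WSet.{u} ⥤ WeightedFree.BAlg.{u})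
      (adj : L ⊣ WeightedFree.BAlg.toWSet.{u})
      (e : WeightedFree.freeBAl.{u} ⟶ L ⋙ WeightedFree.BAlg.incl.{u}),
      (∀ W : WeightedFree.WSet.{u}, WeightedFree.IsCanonicalExtension (e.app W)) ∧
      ∀ W : WeightedFree.WSet.{u}, adj.unit.app W =
        WeightedFree.freeUnit W ≫ WeightedFree.BAl.toWSet.map (e.app W) := by
  open WeightedFree in
  have he : ∀ (W : WSet.{u}) (C D : BAlg.{u}) (g : C ⟶ D) (h : Bdd.basic (Box W) ⟶ C),
      Box.homEquiv W D (h ≫ g) = Box.homEquiv W C h ≫ BAlg.toWSet.map g := fun _ _ _ _ _ => rfl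
  let adj := Adjunction.adjunctionOfEquivLeft Box.homEquiv he
  have hunit : ∀ W, adj.unit.app W = Box.unit W := fun W => by
    simp only [adj, Adjunction.adjunctionOfEquivLeft, Adjunction.mkOfHomEquiv_unit_app]
    rfl
  refine ⟨_, adj, ⟨fun W => Box.rep W, fun V W h => ?_⟩,
    Box.isCanonicalExtension_rep, hunit⟩
  -- Naturality of `e` can be checked on generators, where it is naturality of the unit.
  refine free_hom_ext ?_
  have hnat := adj.unit.naturality h
  rw [hunit, hunit] at hnat
  exact hnat
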